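/- **Soundness of IPDEL.** Fix a set $\mathsf{Ag}$ of agents and a set $\mathsf{AtProp}$ of proposition letters. *Language.* Formulas are given by $$\varphi ::= p\mid\bot\mid\varphi\wedge\varphi\mid\varphi\vee\varphi\mid\varphi\to\varphi\mid\lozenge_i\varphi\mid\Box_i\varphi\mid\langle\mathcal E,e\rangle\varphi\mid[\mathcal E,e]\varphi\mid \textstyle\sum_{k=1}^n\alpha_k\mu_i(\varphi_k)\ge\beta ,$$ with real $\alpha_k,\beta$ and $n\ge 0$; $\top,\neg,\leftrightarrow$ are the usual abbreviations, and for linear terms $t,t'$ of one agent: $\beta\ge t$ is $-t\ge-\beta$; $t>\gamma$ is $\neg(\gamma\ge t)$; $t\ge t'$ is $t-t'\ge0$; $=$ is the conjunction of $\ge$ and $\le$; and, for a number $d$, $d\ge 0$ is the inequality $0\geq -d$ whose left side is the empty sum. Here $\mathcal E=(E,(\sim_i),(P_i),(\Phi,\prec),\mathsf{pre},\mathbf{sub})$ is an *event structure*: $E$ is finite and non-empty, $e\in E$, each $\sim_i$ is an equivalence relation on $E$, $P_i:E\to\,]0,1]$ sums to $1$ on each $\sim_i$-class, $\Phi$ is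 a finite set of formulas with a strict partial order $\prec$ such that $\phi\prec\psi$ implies $\vdash\phi\to\psi$ and distinct $\prec$-incomparable $\phi,\psi$ satisfy $\vdash\neg(\phi\wedge\psi)$, $\mathsf{pre}(\bullet\mid\phi)$ is a probability distribution on $E$ for each $\phi\in\Phi$ such that $\phi\prec\psi$ and $\mathsf{pre}(e\mid\phi)=0$ imply $\mathsf{pre}(e\mid\psi)=0$, and $\mathbf{sub}(e):\mathsf{AtProp}\to\{\text{formulas}\}$ moves only finitely many letters. Formulas, event structures and derivability $\vdash$ are defined by simultaneous induction. Put $\mathsf{pre}(e)=\bigvee\{\phi\in\Phi\mid\mathsf{pre}(e\mid\phi)\ne0\}$, let $\mathrm{mb}(\phi)$ be the set of $\prec$-maximal elements of $\{\sigma\in\Phi\mid\sigma\prec\phi\}$, and $\mu_i^\phi(\psi)=\mu_i(\psi\wedge\phi)-\sum_{\sigma\in\mathrm{mb}(\phi)}\mu_i(\psi\wedge\sigma)$. *Axiom schemes and rules* ($A,B,C,\varphi,\psi,\dots$ arbitrary formulas, $t$ a linear term): - H1 $A\to(B\to A)$; H2 $(A\to(B\to C))\to((A\to B)\to(A\to C))$;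 H3 $A\to(B\to A\wedge B)$; H4 $(A\to C)\to((B\to C)\to(A\vee B\to C))$; H5 $A\wedge B\to A$; H6 $A\wedge B\to B$; H7 $A\to A\vee B$; H8 $B\to A\vee B$; H9 $\bot\to A$. - M1 $A\to\lozenge_iA$; M2 $\Box_iA\to A$; M3 $\lozenge_i(A\vee B)\to\lozenge_iA\vee\lozenge_iB$; M4 $\Box_i(A\to B)\to(\Box_iA\to\Box_iB)$; M5 $\lozenge_iA\to\Box_i\lozenge_iA$; M6 $\lozenge_i\Box_iA\to\Box_iA$; M7 $\Box_i(A\to B)\to(\lozenge_iA\to\lozenge_iB)$; E $\lozenge_iA\vee\neg\lozenge_iA$. - N0 $t\ge t$; N1 $(t\ge\beta)\leftrightarrow(t+0\cdot\mu_i(\varphi)\ge\beta)$; N2 permutation of the summands of $t$ in $t\ge\beta$; N3 $(\sum\alpha_k\mu_i(\varphi_k)\ge\beta)\wedge(\sum\alpha'_k\mu_i(\varphi_k)\ge\beta')\to\sum(\alpha_k+\alpha_k')\mu_i(\varphi_k)\ge\beta+\beta'$; N4 $(t\ge\beta)\wedge(d\ge0)\to(d\cdot t\ge d\beta)$; N5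 $(t\ge\beta)\vee(\beta\ge t)$; N6 $(t\ge\beta)\to(t>\gamma)$ for $\gamma<\beta$. - P1 $\mu_i(\bot)=0$; P2 $\mu_i(\top)=1$; P3 $\mu_i(\varphi)+\mu_i(\psi)=\mu_i(\varphi\vee\psi)+\mu_i(\varphi\wedge\psi)$; P4 $[\Box_i(\varphi\to\psi)\wedge(\mu_i(\varphi)=\mu_i(\psi))]\leftrightarrow\Box_i(\psi\leftrightarrow\varphi)$; P5 $(t\ge\beta)\to\Box_i(t\ge\beta)$. - I1 $[\mathcal E,e]p\leftrightarrow(\mathsf{pre}(e)\to\mathbf{sub}(e)(p))$; I2 $\langle\mathcal E,e\rangle p\leftrightarrow\mathsf{pre}(e)\wedge\mathbf{sub}(e)(p)$; I3 $[\mathcal E,e]\top\leftrightarrow\top$; I4 $\langle\mathcal E,e\rangle\top\leftrightarrow\mathsf{pre}(e)$; I5 $[\mathcal E,e]\bot\leftrightarrow\neg\mathsf{pre}(e)$; I6 $\langle\mathcal E,e\rangle\bot\leftrightarrow\bot$; I7 $[\mathcal E,e](\varphi\wedge\psi)\leftrightarrow[\mathcal E,e]\varphi\wedge[\mathcal E,e]\psi$;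 I8 $\langle\mathcal E,e\rangle(\varphi\wedge\psi)\leftrightarrow\langle\mathcal E,e\rangle\varphi\wedge\langle\mathcal E,e\rangle\psi$; I9 $[\mathcal E,e](\varphi\vee\psi)\leftrightarrow(\mathsf{pre}(e)\to\langle\mathcal E,e\rangle\varphi\vee\langle\mathcal E,e\rangle\psi)$; I10 $\langle\mathcal E,e\rangle(\varphi\vee\psi)\leftrightarrow\langle\mathcal E,e\rangle\varphi\vee\langle\mathcal E,e\rangle\psi$; I11 $[\mathcal E,e](\varphi\to\psi)\leftrightarrow(\langle\mathcal E,e\rangle\varphi\to\langle\mathcal E,e\rangle\psi)$; I12 $\langle\mathcal E,e\rangle(\varphi\to\psi)\leftrightarrow\mathsf{pre}(e)\wedge(\langle\mathcal E,e\rangle\varphi\to\langle\mathcal E,e\rangle\psi)$; I13/I14 $[\mathcal E,e]\lozenge_i\psi\leftrightarrow(\mathsf{pre}(e)\to\bigvee_{e'\sim_ie}\lozenge_i\langle\mathcal E,e'\rangle\psi)$ and $\langle\mathcal E,e\rangle\lozenge_i\psi\leftrightarrow\mathsf{pre}(e)\wedge\bigvee_{e'\sim_ie}\lozenge_i\langle\mathcal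 E,e'\rangle\psi$; I15/I16 $[\mathcal E,e]\Box_i\psi\leftrightarrow(\mathsf{pre}(e)\to\bigwedge_{e'\sim_ie}\Box_i[\mathcal E,e']\psi)$ and $\langle\mathcal E,e\rangle\Box_i\psi\leftrightarrow\mathsf{pre}(e)\wedge\bigwedge_{e'\sim_ie}\Box_i[\mathcal E,e']\psi$; I17/I18 $[\mathcal E,e](\alpha\mu_i(\psi)\ge\beta)\leftrightarrow(\mathsf{pre}(e)\to(C+D\ge0))$ and $\langle\mathcal E,e\rangle(\alpha\mu_i(\psi)\ge\beta)\leftrightarrow\mathsf{pre}(e)\wedge(C+D\ge0)$, where $C=\sum_{e'\sim_ie,\ \phi\in\Phi}\alpha P_i(e')\mathsf{pre}(e'\mid\phi)\mu_i^\phi([\mathcal E,e']\psi)$ and $D=\sum_{e'\sim_ie,\ \phi\in\Phi}-\beta P_i(e')\mathsf{pre}(e'\mid\phi)\mu_i^\phi(\top)$. - Rules: modus ponens; from $\vdash A$ infer $\vdash\Box_iA$ and $\vdash[\mathcal E,e]A$; from $\vdash A\to B$ infer $\vdash\mu_i(A)\le\mu_i(B)$; from $\vdash A\leftrightarrow B$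 infer $\vdash\varphi\leftrightarrow\varphi'$, where the formula $\varphi'$ arises from the formula $\varphi$ by replacing some occurrences of $A$ by $B$. *Models.* An epistemic Heyting algebra $\mathbb A$ is a finite Heyting algebra with monotone operations $\lozenge_i,\Box_i$ such that $a\le\lozenge_ia$, $\Box_ia\le a$, $\lozenge_i(a\vee b)\le\lozenge_ia\vee\lozenge_ib$, $\Box_i(a\to b)\le\Box_ia\to\Box_ib$, $\lozenge_ia\le\Box_i\lozenge_ia$, $\lozenge_i\Box_ia\le\Box_ia$, $\Box_i(a\to b)\le\lozenge_ia\to\lozenge_ib$, $\lozenge_i\bot\le\bot$, $\top\le\Box_i\top$ and $\lozenge_ia\vee\neg\lozenge_ia=\top$. An element is $i$-minimal if it is a minimal non-$\bot$ fixed point of $\lozenge_i$; $\mathsf{Min}_i(\mathbb A)$ is the set of these. An $i$-measure is a monotone map $\mu_i:\mathsf{Min}_i(\mathbb A){\downarrow}\to\mathbb R_{\ge0}$ with $\mu_i(\bot)=0$ (if the domain is non-empty) and, for $a\in\mathsf{Min}_i(\mathbb A)$ and $b,c\le a$: $\mu_i(b\vee c)=\mu_i(b)+\mu_i(c)-\mu_i(b\wedge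 c)$, $\mu_i(b)<\mu_i(c)$ if $b<c$, and $\mu_i(a)=1$. An *APE-model* $\mathcal M=(\mathbb A,(\mu_i)_i,v)$ is an epistemic Heyting algebra with an $i$-measure for each $i\in\mathsf{Ag}$ and a valuation $v:\mathsf{AtProp}\to\mathbb A$. *Semantics.* $[\![\cdot]\!]_{\mathcal M}$ is $v$ on letters and commutes with $\bot,\wedge,\vee,\to,\lozenge_i,\Box_i$; $[\![\sum\alpha_k\mu_i(\varphi_k)\ge\beta]\!]_{\mathcal M}=\bigvee\{a\in\mathsf{Min}_i(\mathbb A)\mid\sum\alpha_k\mu_i([\![\varphi_k]\!]_{\mathcal M}\wedge a)\ge\beta\}$; $[\![\langle\mathcal E,e\rangle\varphi]\!]_{\mathcal M}=\overline{\mathsf{pre}}(e)\wedge g(e)$ and $[\![[\mathcal E,e]\varphi]\!]_{\mathcal M}=\overline{\mathsf{pre}}(e)\to g(e)$, where $\overline{\mathsf{pre}}(e)=\bigvee\{[\![\phi]\!]_{\mathcal M}\mid\phi\in\Phi,\ \mathsf{pre}(e\mid\phi)\ne0\}$ and $g\in\mathbb A^E$ is the representative below $\overline{\mathsf{pre}}$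 of the class $[\![\varphi]\!]_{\mathcal M^{\mathcal E}}$. The updated model $\mathcal M^{\mathcal E}$ has as algebra the quotient of $\mathbb A^E$ by $f\cong f'\iff f\wedge\overline{\mathsf{pre}}=f'\wedge\overline{\mathsf{pre}}$, with $\lozenge_i[f]=[\lozenge'_i(f\wedge\overline{\mathsf{pre}})]$, $\Box_i[f]=[\Box'_i(\overline{\mathsf{pre}}\to f)]$, where $(\lozenge'_if)(e)=\bigvee_{e'\sim_ie}\lozenge_if(e')$ and $(\Box'_if)(e)=\bigwedge_{e'\sim_ie}\Box_if(e')$; with valuation $p\mapsto[e\mapsto[\![\mathbf{sub}(e)(p)]\!]_{\mathcal M}]$; and with measures $\mu_i^{\mathcal E}(\bot)=0$ and, for $\bot\ne[g]\le[f]\in\mathsf{Min}_i$ and representatives $g,f\le\overline{\mathsf{pre}}$, $\mu_i^{\mathcal E}([g])=\mu'_i(g)/\mu'_i(f)$, where $\mu_i'(h)=\sum_{e\in E}\sum_{\phi\in\Phi}P_i(e)\,\mathsf{pre}(e\mid\phi)\big(\mu_i(h(e)\wedge[\![\phi]\!]_{\mathcal M})-\sum_{\sigma\in\mathrm{mb}(\phi)}\mu_i(h(e)\wedge[\![\sigma]\!]_{\mathcal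 M})\big)$. **Claim.** The axiomatization is sound with respect to APE-models: if $\vdash\varphi$, then $[\![\varphi]\!]_{\mathcal M}=\top$ for every APE-model $\mathcal M$. -/

import Mathlib

/-! # Intuitionistic probabilistic dynamic epistemic logic (IPDEL) -/

universe u v w

namespace IPDEL

/-! ## Finite epistemic Heyting algebras and measures -/

section Algebra

/-- Monadic Heyting algebras: the laws of the families `◇ᵢ = dia i` and `□ᵢ = box i`. -/
structure IsMonadic {Ag A : Type*} [HeytingAlgebra A] (dia box : Ag → A → A) : Prop where
  dia_mono : ∀ i, Monotone (dia i)
  box_mono : ∀ i, Monotone (box i)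
  m1 : ∀ i a, a ≤ dia i a
  m2 : ∀ i a, box i a ≤ a
  m3 : ∀ i a b, dia i (a ⊔ b) ≤ dia i a ⊔ dia i b
  m4 : ∀ i a b, box i (a ⇨ b) ≤ box i a ⇨ box i b
  m5 : ∀ i a, dia i a ≤ box i (dia i a)
  m6 : ∀ i a, dia i (box i a) ≤ box i a
  m7 : ∀ i a b, box i (a ⇨ b) ≤ dia i a ⇨ dia i b
  m8 : ∀ i, dia i ⊥ ≤ ⊥
  m9 : ∀ i, ⊤ ≤ box i ⊤

/-- Epistemic Heyting algebras are the finite monadic Heyting algebras that satisfy `(E)`. -/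
structure IsEpistemic {Ag A : Type*} [HeytingAlgebra A] (dia box : Ag → A → A) : Prop
    extends IsMonadic dia box where
  finite : Finite A
  e : ∀ i a, dia i a ⊔ (dia i a)ᶜ = ⊤

/-- `a` is an `i`-minimal element, where `d` is the operation `◇ᵢ`. -/
def IsMin {A : Type*} [HeytingAlgebra A] (d : A → A) (a : A) : Prop :=
  a ≠ ⊥ ∧ d a = a ∧ ∀ b, b < a → d b = b → b = ⊥

/-- `i`-premeasures. A partial function with domain the down-set generated by the `i`-minimal
elements is represented by a total function, about which only the values on that domain matter. -/
structure IsPremeasure {A : Type*} [HeytingAlgebra A] (d : A → A) (μ : A → ℝ) : Prop where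
  nonneg : ∀ a, IsMin d a → ∀ b, b ≤ a → 0 ≤ μ b
  mono : ∀ a, IsMin d a → ∀ b c, b ≤ c → c ≤ a → μ b ≤ μ c
  join : ∀ a, IsMin d a → ∀ b c, b ≤ a → c ≤ a → μ (b ⊔ c) = μ b + μ c - μ (b ⊓ c)
  bot : (∃ a, IsMin d a) → μ ⊥ = 0

/-- `i`-measures. -/
structure IsMeasure {A : Type*} [HeytingAlgebra A] (d : A → A) (μ : A → ℝ) : Prop
    extends IsPremeasure d μ where
  strict : ∀ a, IsMin d a → ∀ b c, b < c → c ≤ a → μ b < μ c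
  one : ∀ a, IsMin d a → μ a = 1

end Algebra

/-! ## The pseudo-quotient of a Heyting algebra -/

section PseudoQuotient

variable {A : Type*} [HeytingAlgebra A]

/-- `b ≅ₐ c` iff `b ⊓ a = c ⊓ a`. -/
def pqSetoid (a : A) : Setoid A where
  r b c := b ⊓ a = c ⊓ a
  iseqv := ⟨fun _ => rfl, fun h => h.symm, fun h h' => h.trans h'⟩

/-- The quotient of `A` by `≅ₐ`. -/
def PQ (a : A) : Type _ := Quotient (pqSetoid a)

/-- The class of an element. -/
def PQ.mk (a b : A) : PQ a := Quotient.mk (pqSetoid a) b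

/-- The map `ι : [g] ↦ g ⊓ a`. -/
def PQ.iota (a : A) (q : PQ a) : A :=
  Quotient.lift (s := pqSetoid a) (fun b => b ⊓ a) (fun _ _ h => h) q

theorem PQ.iota_mk (a b : A) : PQ.iota a (PQ.mk a b) = b ⊓ a := rfl

theorem PQ.mk_eq {a b c : A} (h : b ⊓ a = c ⊓ a) : PQ.mk a b = PQ.mk a c :=
  Quotient.sound (s := pqSetoid a) h

theorem PQ.mk_iota (a : A) (q : PQ a) : PQ.mk a (PQ.iota a q) = q := by
  induction q using Quotient.ind with
  | _ b => exact PQ.mk_eq (inf_assoc b a a |>.trans (by rw [inf_idem]))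

theorem PQ.iota_inj {a : A} {q r : PQ a} (h : PQ.iota a q = PQ.iota a r) : q = r := by
  rw [← PQ.mk_iota a q, ← PQ.mk_iota a r, h]

theorem PQ.iota_le (a : A) (q : PQ a) : PQ.iota a q ≤ a := by
  induction q using Quotient.ind with
  | _ b => exact inf_le_right

instance PQ.instFinite [Finite A] (a : A) : Finite (PQ a) :=
  inferInstanceAs (Finite (Quotient (pqSetoid a)))

/-- All operations are those of `A`, applied to representatives. -/
instance PQ.instHeyting (a : A) : HeytingAlgebra (PQ a) where
  le q r := PQ.iota a q ≤ PQ.iota a r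
  le_refl _ := le_rfl
  le_trans _ _ _ h h' := le_trans h h'
  le_antisymm _ _ h h' := PQ.iota_inj (le_antisymm h h')
  sup q r := PQ.mk a (PQ.iota a q ⊔ PQ.iota a r)
  inf q r := PQ.mk a (PQ.iota a q ⊓ PQ.iota a r)
  top := PQ.mk a ⊤
  bot := PQ.mk a ⊥
  himp q r := PQ.mk a (PQ.iota a q ⇨ PQ.iota a r)
  compl q := PQ.mk a (PQ.iota a q)ᶜ
  le_sup_left q r := le_inf le_sup_left (PQ.iota_le a q)
  le_sup_right q r := le_inf le_sup_right (PQ.iota_le a r)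
  sup_le q r s h h' := le_trans inf_le_left (sup_le h h')
  inf_le_left q r := le_trans inf_le_left inf_le_left
  inf_le_right q r := le_trans inf_le_left inf_le_right
  le_inf q r s h h' := le_inf (le_inf h h') (PQ.iota_le a q)
  le_top q := le_inf le_top (PQ.iota_le a q)
  bot_le q := le_trans inf_le_left bot_le
  le_himp_iff q r s := by
    change PQ.iota a q ≤ (PQ.iota a r ⇨ PQ.iota a s) ⊓ a ↔
      (PQ.iota a q ⊓ PQ.iota a r) ⊓ a ≤ PQ.iota a s
    rw [le_inf_iff, le_himp_iff]
    constructor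
    · exact fun h => le_trans inf_le_left h.1
    · refine fun h => ⟨le_trans (le_inf le_rfl ?_) h, PQ.iota_le a q⟩
      exact le_trans inf_le_left (PQ.iota_le a q)
  himp_bot q := PQ.mk_eq (by
    change (PQ.iota a q ⇨ ⊥ ⊓ a) ⊓ a = (PQ.iota a q)ᶜ ⊓ a
    rw [bot_inf_eq, himp_bot])

/-- `◇ᵢᵃ [b] = [◇ᵢ (b ⊓ a)]`. -/
def PQ.dia (a : A) (d : A → A) (q : PQ a) : PQ a :=
  Quotient.lift (s := pqSetoid a) (fun b => PQ.mk a (d (b ⊓ a)))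
    (fun _ _ h => congrArg (fun x => PQ.mk a (d x)) h) q

/-- `□ᵢᵃ [b] = [□ᵢ (a ⇨ b)]`. -/
def PQ.box (a : A) (bx : A → A) (q : PQ a) : PQ a :=
  Quotient.lift (s := pqSetoid a) (fun b => PQ.mk a (bx (a ⇨ b)))
    (fun b c h => by
      have h' : a ⇨ b = a ⇨ c := by
        have key : ∀ x : A, a ⇨ x = a ⇨ (x ⊓ a) := fun x => by
          rw [himp_inf_distrib, himp_self, inf_top_eq]
        rw [key b, key c]
        exact congrArg (fun x => a ⇨ x) h
      exact congrArg (fun x => PQ.mk a (bx x)) h') q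

end PseudoQuotient

/-! ## Event structures: the part that does not mention formulas -/

/-- The events are `Fin n` and the elements of `Φ` are indexed by `Fin m`. The relation `prec`
is the strict order on (the index set of) `Φ`, and `compat` is the compatibility of the
precondition map with it. -/
structure EventFrame (Ag : Type*) where
  n : ℕ
  m : ℕ
  nonempty : 0 < n
  rel : Ag → Fin n → Fin n → Prop
  rel_equiv : ∀ i, Equivalence (rel i)
  P : Ag → Fin n → ℝ
  P_pos : ∀ i e, 0 < P i e
  P_sum : ∀ i e, (open scoped Classical in ∑ e' with rel i e' e, P i e') = 1
  prec : Fin m → Fin m → Prop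
  prec_irrefl : ∀ k, ¬ prec k k
  prec_trans : ∀ k l o, prec k l → prec l o → prec k o
  pre : Fin n → Fin m → ℝ
  pre_nonneg : ∀ e k, 0 ≤ pre e k
  pre_sum : ∀ k, ∑ e, pre e k = 1
  compat : ∀ e k l, prec k l → pre e k = 0 → pre e l = 0

/-- `mb(k)`: the maximal elements strictly below `k`. -/
noncomputable def EventFrame.mb {Ag : Type*} (F : EventFrame Ag) (k : Fin F.m) :
    Finset (Fin F.m) :=
  open scoped Classical in
  Finset.univ.filter fun l => F.prec l k ∧ ∀ o, F.prec o k → ¬ F.prec l o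

/-! ## Formulas -/

/-- Formulas. In the dynamic modalities `⟨𝓔, e⟩ φ` and `[𝓔, e] φ` the event structure `𝓔` is given
by its frame, its family `Φ` of formulas and its substitution map; `prob i n α φ β` is the formula
`∑ₖ αₖ μᵢ(φₖ) ≥ β`. -/
inductive Formula (Ag : Type*) (At : Type*) where
  | atom (p : At)
  | bot
  | and (φ ψ : Formula Ag At)
  | or (φ ψ : Formula Ag At)
  | imp (φ ψ : Formula Ag At)
  | dia (i : Ag) (φ : Formula Ag At)
  | box (i : Ag) (φ : Formula Ag At)
  | evDia (F : EventFrame Ag) (Φ : Fin F.m → Formula Ag At)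
      (sub : Fin F.n → At → Formula Ag At) (e : Fin F.n) (φ : Formula Ag At)
  | evBox (F : EventFrame Ag) (Φ : Fin F.m → Formula Ag At)
      (sub : Fin F.n → At → Formula Ag At) (e : Fin F.n) (φ : Formula Ag At)
  | prob (i : Ag) (n : ℕ) (α : Fin n → ℝ) (φ : Fin n → Formula Ag At) (β : ℝ)

/-- Event structures over the language (the conditions that involve formulas and derivability
are in `WFEvent` below). -/
structure EventStr (Ag : Type*) (At : Type*) where
  frame : EventFrame Ag
  Φ : Fin frame.m → Formula Ag At
  sub : Fin frame.n → At → Formula Ag At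

namespace Formula

variable {Ag At : Type*}

/-- `⊤` -/
def top : Formula Ag At := imp bot bot

/-- `¬ φ` -/
def neg (φ : Formula Ag At) : Formula Ag At := imp φ bot

/-- `φ ↔ ψ` -/
def iff (φ ψ : Formula Ag At) : Formula Ag At := and (imp φ ψ) (imp ψ φ)

/-- finite disjunction -/
def bigOr : List (Formula Ag At) → Formula Ag At
  | [] => bot
  | φ :: l => or φ (bigOr l)

/-- finite conjunction -/
def bigAnd : List (Formula Ag At) → Formula Ag At
  | [] => top
  | φ :: l => and φ (bigAnd l)

/-- `⟨𝓔, e⟩ φ` -/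
def dDia (E : EventStr Ag At) (e : Fin E.frame.n) (φ : Formula Ag At) : Formula Ag At :=
  evDia E.frame E.Φ E.sub e φ

/-- `[𝓔, e] φ` -/
def dBox (E : EventStr Ag At) (e : Fin E.frame.n) (φ : Formula Ag At) : Formula Ag At :=
  evBox E.frame E.Φ E.sub e φ

end Formula

/-! ### Linear terms `∑ₖ αₖ μᵢ(φₖ)` and derived inequalities -/

/-- The linear term `∑ₖ αₖ μᵢ(φₖ)`. -/
structure LTerm (Ag : Type*) (At : Type*) where
  n : ℕ
  coeff : Fin n → ℝ
  arg : Fin n → Formula Ag At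

namespace LTerm

variable {Ag At : Type*}

/-- the empty sum -/
def zero : LTerm Ag At := ⟨0, Fin.elim0, Fin.elim0⟩

/-- `α μ(φ)` -/
def single (α : ℝ) (φ : Formula Ag At) : LTerm Ag At := ⟨1, fun _ => α, fun _ => φ⟩

/-- `μ(φ)` -/
def mu (φ : Formula Ag At) : LTerm Ag At := single 1 φ

/-- `t + t'` -/
def add (t t' : LTerm Ag At) : LTerm Ag At :=
  ⟨t.n + t'.n, Fin.append t.coeff t'.coeff, Fin.append t.arg t'.arg⟩

/-- `d · t` -/
def smul (d : ℝ) (t : LTerm Ag At) : LTerm Ag At := ⟨t.n, fun k => d * t.coeff k, t.arg⟩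

/-- `- t` -/
def neg (t : LTerm Ag At) : LTerm Ag At := smul (-1) t

/-- finite sums of terms -/
def bigSum : List (LTerm Ag At) → LTerm Ag At
  | [] => zero
  | t :: l => add t (bigSum l)

/-- `t ≥ β` -/
def ge (i : Ag) (t : LTerm Ag At) (β : ℝ) : Formula Ag At := .prob i t.n t.coeff t.arg β

/-- `β ≥ t`, i.e. `- t ≥ - β` -/
def le (i : Ag) (t : LTerm Ag At) (β : ℝ) : Formula Ag At := ge i (neg t) (-β)

/-- `t > γ`, i.e. `¬ (γ ≥ t)` -/
def gt (i : Ag) (t : LTerm Ag At) (γ : ℝ) : Formula Ag At := .neg (le i t γ)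

/-- `t = β` -/
def eq (i : Ag) (t : LTerm Ag At) (β : ℝ) : Formula Ag At := .and (ge i t β) (le i t β)

/-- `t ≥ t'`, i.e. `t - t' ≥ 0` -/
def geT (i : Ag) (t t' : LTerm Ag At) : Formula Ag At := ge i (add t (neg t')) 0

/-- `t = t'` -/
def eqT (i : Ag) (t t' : LTerm Ag At) : Formula Ag At := .and (geT i t t') (geT i t' t)

/-- the inequality `d ≥ 0` for a number `d`, i.e. (the empty sum) `≥ - d` -/
def constNonneg (i : Ag) (d : ℝ) : Formula Ag At := ge i zero (-d)

end LTerm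

namespace EventStr

variable {Ag At : Type*}

/-- The formula `pre(e)`: the disjunction of the `φ ∈ Φ` with `pre(e ∣ φ) ≠ 0`. -/
noncomputable def preF (E : EventStr Ag At) (e : Fin E.frame.n) : Formula Ag At :=
  open scoped Classical in
  Formula.bigOr (((List.finRange E.frame.m).filter fun k => E.frame.pre e k ≠ 0).map E.Φ)

/-- The events `e' ∼ᵢ e`, as a list. -/
noncomputable def cell (E : EventStr Ag At) (i : Ag) (e : Fin E.frame.n) :
    List (Fin E.frame.n) :=
  open scoped Classical in
  (List.finRange E.frame.n).filter fun e' => E.frame.rel i e' e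

/-- The term `μ^φ(ψ) = μ(ψ ∧ φ) - ∑_{σ ∈ mb(φ)} μ(ψ ∧ σ)` for `φ = Φ k`. -/
noncomputable def muT (E : EventStr Ag At) (k : Fin E.frame.m) (ψ : Formula Ag At) :
    LTerm Ag At :=
  open scoped Classical in
  LTerm.add (LTerm.mu (.and ψ (E.Φ k)))
    (LTerm.neg (LTerm.bigSum (((List.finRange E.frame.m).filter fun l => l ∈ E.frame.mb k).map
      fun l => LTerm.mu (.and ψ (E.Φ l)))))

/-- The term `∑_{e' ∼ᵢ e, φ ∈ Φ} c · Pᵢ(e') · pre(e' ∣ φ) · μ^φ(χ(e'))`. -/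
noncomputable def sumT (E : EventStr Ag At) (i : Ag) (e : Fin E.frame.n) (c : ℝ)
    (χ : Fin E.frame.n → Formula Ag At) : LTerm Ag At :=
  LTerm.bigSum ((E.cell i e).map fun e' =>
    LTerm.bigSum ((List.finRange E.frame.m).map fun k =>
      LTerm.smul (c * E.frame.P i e' * E.frame.pre e' k) (E.muT k (χ e'))))

/-- The formula `C + D ≥ 0` of the reduction axioms for `α μᵢ(ψ) ≥ β`. -/
noncomputable def redF (E : EventStr Ag At) (i : Ag) (e : Fin E.frame.n) (α β : ℝ)
    (ψ : Formula Ag At) : Formula Ag At :=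
  LTerm.ge i (LTerm.add (E.sumT i e α fun e' => .dBox E e' ψ)
    (E.sumT i e (-β) fun _ => .top)) 0

end EventStr

/-! ## The axiomatization -/

open Formula in
/-- The axiom schemes. -/
inductive Ax {Ag At : Type*} : Formula Ag At → Prop
  -- intuitionistic propositional logic
  | h1 (A B) : Ax (imp A (imp B A))
  | h2 (A B C) : Ax (imp (imp A (imp B C)) (imp (imp A B) (imp A C)))
  | h3 (A B) : Ax (imp A (imp B (and A B)))
  | h4 (A B C) : Ax (imp (imp A C) (imp (imp B C) (imp (or A B) C)))
  | h5 (A B) : Ax (imp (and A B) A)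
  | h6 (A B) : Ax (imp (and A B) B)
  | h7 (A B) : Ax (imp A (or A B))
  | h8 (A B) : Ax (imp B (or A B))
  | h9 (A) : Ax (imp bot A)
  -- static modalities
  | m1 (i A) : Ax (imp A (dia i A))
  | m2 (i A) : Ax (imp (box i A) A)
  | m3 (i A B) : Ax (imp (dia i (or A B)) (or (dia i A) (dia i B)))
  | m4 (i A B) : Ax (imp (box i (imp A B)) (imp (box i A) (box i B)))
  | m5 (i A) : Ax (imp (dia i A) (box i (dia i A)))
  | m6 (i A) : Ax (imp (dia i (box i A)) (box i A))
  | m7 (i A B) : Ax (imp (box i (imp A B)) (imp (dia i A) (dia i B)))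
  | e (i A) : Ax (or (dia i A) (neg (dia i A)))
  -- inequalities
  | n0 (i) (t : LTerm Ag At) : Ax (LTerm.geT i t t)
  | n1 (i) (t : LTerm Ag At) (β : ℝ) (φ) :
      Ax (iff (LTerm.ge i t β) (LTerm.ge i (t.add (.single 0 φ)) β))
  | n2 (i) (n : ℕ) (α : Fin n → ℝ) (φ : Fin n → Formula Ag At) (β : ℝ)
      (σ : Equiv.Perm (Fin n)) :
      Ax (imp (prob i n α φ β) (prob i n (fun k => α (σ k)) (fun k => φ (σ k)) β))
  | n3 (i) (n : ℕ) (α α' : Fin n → ℝ) (φ : Fin n → Formula Ag At) (β β' : ℝ) :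
      Ax (imp (and (prob i n α φ β) (prob i n α' φ β'))
        (prob i n (fun k => α k + α' k) φ (β + β')))
  | n4 (i) (t : LTerm Ag At) (β d : ℝ) :
      Ax (imp (and (LTerm.ge i t β) (LTerm.constNonneg i d))
        (LTerm.ge i (t.smul d) (d * β)))
  | n5 (i) (t : LTerm Ag At) (β : ℝ) : Ax (or (LTerm.ge i t β) (LTerm.le i t β))
  | n6 (i) (t : LTerm Ag At) (β γ : ℝ) (h : γ < β) :
      Ax (imp (LTerm.ge i t β) (LTerm.gt i t γ))
  -- probabilities
  | p1 (i) : Ax (LTerm.eq i (.mu bot) 0)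
  | p2 (i) : Ax (LTerm.eq i (.mu top) 1)
  | p3 (i φ ψ) : Ax (LTerm.eqT i ((LTerm.mu φ).add (.mu ψ))
      ((LTerm.mu (or φ ψ)).add (.mu (and φ ψ))))
  | p4 (i φ ψ) : Ax (iff (and (box i (imp φ ψ)) (LTerm.eqT i (.mu φ) (.mu ψ)))
      (box i (iff ψ φ)))
  | p5 (i) (n : ℕ) (α : Fin n → ℝ) (φ : Fin n → Formula Ag At) (β : ℝ) :
      Ax (imp (prob i n α φ β) (box i (prob i n α φ β)))
  -- reduction axioms
  | i1 (E : EventStr Ag At) (e p) :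
      Ax (iff (dBox E e (atom p)) (imp (E.preF e) (E.sub e p)))
  | i2 (E : EventStr Ag At) (e p) :
      Ax (iff (dDia E e (atom p)) (and (E.preF e) (E.sub e p)))
  | i3 (E : EventStr Ag At) (e) : Ax (iff (dBox E e top) top)
  | i4 (E : EventStr Ag At) (e) : Ax (iff (dDia E e top) (E.preF e))
  | i5 (E : EventStr Ag At) (e) : Ax (iff (dBox E e bot) (neg (E.preF e)))
  | i6 (E : EventStr Ag At) (e) : Ax (iff (dDia E e bot) bot)
  | i7 (E : EventStr Ag At) (e φ ψ) :
      Ax (iff (dBox E e (and φ ψ)) (and (dBox E e φ) (dBox E e ψ)))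
  | i8 (E : EventStr Ag At) (e φ ψ) :
      Ax (iff (dDia E e (and φ ψ)) (and (dDia E e φ) (dDia E e ψ)))
  | i9 (E : EventStr Ag At) (e φ ψ) :
      Ax (iff (dBox E e (or φ ψ)) (imp (E.preF e) (or (dDia E e φ) (dDia E e ψ))))
  | i10 (E : EventStr Ag At) (e φ ψ) :
      Ax (iff (dDia E e (or φ ψ)) (or (dDia E e φ) (dDia E e ψ)))
  | i11 (E : EventStr Ag At) (e φ ψ) :
      Ax (iff (dBox E e (imp φ ψ)) (imp (dDia E e φ) (dDia E e ψ)))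
  | i12 (E : EventStr Ag At) (e φ ψ) :
      Ax (iff (dDia E e (imp φ ψ)) (and (E.preF e) (imp (dDia E e φ) (dDia E e ψ))))
  | i13 (E : EventStr Ag At) (e i ψ) :
      Ax (iff (dBox E e (dia i ψ))
        (imp (E.preF e) (bigOr ((E.cell i e).map fun e' => dia i (dDia E e' ψ)))))
  | i14 (E : EventStr Ag At) (e i ψ) :
      Ax (iff (dDia E e (dia i ψ))
        (and (E.preF e) (bigOr ((E.cell i e).map fun e' => dia i (dDia E e' ψ)))))
  | i15 (E : EventStr Ag At) (e i ψ) :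
      Ax (iff (dBox E e (box i ψ))
        (imp (E.preF e) (bigAnd ((E.cell i e).map fun e' => box i (dBox E e' ψ)))))
  | i16 (E : EventStr Ag At) (e i ψ) :
      Ax (iff (dDia E e (box i ψ))
        (and (E.preF e) (bigAnd ((E.cell i e).map fun e' => box i (dBox E e' ψ)))))
  | i17 (E : EventStr Ag At) (e i ψ) (α β : ℝ) :
      Ax (iff (dBox E e (LTerm.ge i (.single α ψ) β))
        (imp (E.preF e) (E.redF i e α β ψ)))
  | i18 (E : EventStr Ag At) (e i ψ) (α β : ℝ) :
      Ax (iff (dDia E e (LTerm.ge i (.single α ψ) β))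
        (and (E.preF e) (E.redF i e α β ψ)))

/-- `Repl A B φ φ'`: the formula `φ'` results from `φ` by replacing some occurrences of `A` by
`B`; occurrences inside event structures are included. -/
inductive Repl {Ag At : Type*} (A B : Formula Ag At) : Formula Ag At → Formula Ag At → Prop
  | here : Repl A B A B
  | refl (φ) : Repl A B φ φ
  | and {φ φ' ψ ψ'} : Repl A B φ φ' → Repl A B ψ ψ' → Repl A B (.and φ ψ) (.and φ' ψ')
  | or {φ φ' ψ ψ'} : Repl A B φ φ' → Repl A B ψ ψ' → Repl A B (.or φ ψ) (.or φ' ψ')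
  | imp {φ φ' ψ ψ'} : Repl A B φ φ' → Repl A B ψ ψ' → Repl A B (.imp φ ψ) (.imp φ' ψ')
  | dia {i φ φ'} : Repl A B φ φ' → Repl A B (.dia i φ) (.dia i φ')
  | box {i φ φ'} : Repl A B φ φ' → Repl A B (.box i φ) (.box i φ')
  | evDia {F : EventFrame Ag} {Φ Φ' sub sub' e φ φ'} :
      (∀ k, Repl A B (Φ k) (Φ' k)) → (∀ e' p, Repl A B (sub e' p) (sub' e' p)) →
      Repl A B φ φ' → Repl A B (.evDia F Φ sub e φ) (.evDia F Φ' sub' e φ')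
  | evBox {F : EventFrame Ag} {Φ Φ' sub sub' e φ φ'} :
      (∀ k, Repl A B (Φ k) (Φ' k)) → (∀ e' p, Repl A B (sub e' p) (sub' e' p)) →
      Repl A B φ φ' → Repl A B (.evBox F Φ sub e φ) (.evBox F Φ' sub' e φ')
  | prob {i n α φ φ' β} : (∀ k, Repl A B (φ k) (φ' k)) →
      Repl A B (.prob i n α φ β) (.prob i n α φ' β)

mutual

/-- The formulas of the language: every event structure that occurs satisfies `WFEvent`. -/
inductive WF {Ag : Type u} {At : Type v} : Formula Ag At → Prop
  | atom (p) : WF (.atom p)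
  | bot : WF .bot
  | and {φ ψ} : WF φ → WF ψ → WF (.and φ ψ)
  | or {φ ψ} : WF φ → WF ψ → WF (.or φ ψ)
  | imp {φ ψ} : WF φ → WF ψ → WF (.imp φ ψ)
  | dia {i φ} : WF φ → WF (.dia i φ)
  | box {i φ} : WF φ → WF (.box i φ)
  | evDia {F Φ sub e φ} : WFEvent ⟨F, Φ, sub⟩ → WF φ → WF (.evDia F Φ sub e φ)
  | evBox {F Φ sub e φ} : WFEvent ⟨F, Φ, sub⟩ → WF φ → WF (.evBox F Φ sub e φ)
  | prob {i n α β} {φ : Fin n → Formula Ag At} : (∀ k, WF (φ k)) → WF (.prob i n α φ β)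

/-- The event structures over the language: `Φ` is a finite set of formulas on which `prec`
is an order by derivable implication and of which incomparable members contradict each other;
every substitution moves only finitely many proposition letters. -/
inductive WFEvent {Ag : Type u} {At : Type v} : EventStr Ag At → Prop
  | mk (E : EventStr Ag At) :
      (∀ k, WF (E.Φ k)) →
      (∀ e p, WF (E.sub e p)) →
      Function.Injective E.Φ →
      (∀ e, {p | E.sub e p ≠ .atom p}.Finite) →
      (∀ k l, E.frame.prec k l → Provable (.imp (E.Φ k) (E.Φ l))) →
      (∀ k l, k ≠ l → ¬ E.frame.prec k l → ¬ E.frame.prec l k →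
        Provable (.neg (.and (E.Φ k) (E.Φ l)))) →
      WFEvent E

/-- Derivability `⊢ φ` in IPDEL. -/
inductive Provable {Ag : Type u} {At : Type v} : Formula Ag At → Prop
  | ax {φ} : Ax φ → WF φ → Provable φ
  | mp {A B} : Provable (.imp A B) → Provable A → Provable B
  | nec {A} (i) : Provable A → Provable (.box i A)
  | necE {A} (E : EventStr Ag At) (e) : WFEvent E → Provable A → Provable (.dBox E e A)
  | subMu {A B} (i) : Provable (.imp A B) → Provable (LTerm.geT i (.mu B) (.mu A))
  | subEq {A B φ φ'} : Provable (.iff A B) → WF φ → WF φ' → Repl A B φ φ' →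
      Provable (.iff φ φ')

end

/-! ## Models, updates and the interpretation of formulas -/

/-- The data of an algebraic model; `mu i` is a total function that extends the partial
function `μᵢ`. -/
structure Model (Ag : Type u) (At : Type v) where
  carrier : Type w
  [heyting : HeytingAlgebra carrier]
  [finite : Finite carrier]
  dia : Ag → carrier → carrier
  box : Ag → carrier → carrier
  mu : Ag → carrier → ℝ
  val : At → carrier

attribute [instance] Model.heyting Model.finite

namespace Model

variable {Ag : Type u} {At : Type v}

/-- APE-models. -/
structure IsAPE (M : Model.{u, v, w} Ag At) : Prop where
  epistemic : IsEpistemic M.dia M.box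
  measure : ∀ i, IsMeasure (M.dia i) (M.mu i)

section Update

variable (M : Model.{u, v, w} Ag At) (F : EventFrame Ag) (Φ : Fin F.m → M.carrier)

/-- `◇'ᵢ` on the product algebra. -/
noncomputable def prodDia (i : Ag) (f : Fin F.n → M.carrier) : Fin F.n → M.carrier :=
  open scoped Classical in
  fun e => (Finset.univ.filter fun e' => F.rel i e' e).sup fun e' => M.dia i (f e')

/-- `□'ᵢ` on the product algebra. -/
noncomputable def prodBox (i : Ag) (f : Fin F.n → M.carrier) : Fin F.n → M.carrier :=
  open scoped Classical in
  fun e => (Finset.univ.filter fun e' => F.rel i e' e).inf fun e' => M.box i (f e')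

/-- The element `pre` of the product algebra. -/
noncomputable def preBar : Fin F.n → M.carrier :=
  open scoped Classical in
  fun e => (Finset.univ.filter fun k => F.pre e k ≠ 0).sup Φ

/-- `μᵢᵃ` for `a = Φ k`. -/
noncomputable def muPart (i : Ag) (k : Fin F.m) (x : M.carrier) : ℝ :=
  M.mu i (x ⊓ Φ k) - ∑ l ∈ F.mb k, M.mu i (x ⊓ Φ l)

/-- `μ'ᵢ` on the product algebra. -/
noncomputable def muProd (i : Ag) (f : Fin F.n → M.carrier) : ℝ :=
  ∑ e, ∑ k, F.P i e * muPart M F Φ i k (f e) * F.pre e k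

/-- `◇ᵢ` of the updated algebra. -/
noncomputable def updDia (i : Ag) : PQ (preBar M F Φ) → PQ (preBar M F Φ) :=
  PQ.dia (preBar M F Φ) (prodDia M F i)

/-- `□ᵢ` of the updated algebra. -/
noncomputable def updBox (i : Ag) : PQ (preBar M F Φ) → PQ (preBar M F Φ) :=
  PQ.box (preBar M F Φ) (prodBox M F i)

/-- `μᵢ` of the updated algebra: `[g] ↦ μ'ᵢ(g) / μ'ᵢ(f)`, with `[f]` the `i`-minimal element
above `[g]`, and with the value `0` at `⊥`. The representatives are those below `pre`. -/
noncomputable def updMu (i : Ag) (q : PQ (preBar M F Φ)) : ℝ :=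
  open scoped Classical in
  if q = ⊥ then 0
  else if h : ∃ f, IsMin (updDia M F Φ i) f ∧ q ≤ f then
    muProd M F Φ i (PQ.iota _ q) / muProd M F Φ i (PQ.iota _ h.choose)
  else 0

/-- The updated model, given the interpretations of the formulas in `Φ` and in the
substitution map. -/
noncomputable def update (s : Fin F.n → At → M.carrier) : Model.{u, v, w} Ag At where
  carrier := PQ (preBar M F Φ)
  dia := updDia M F Φ
  box := updBox M F Φ
  mu := updMu M F Φ
  val p := PQ.mk (preBar M F Φ) fun e => s e p

end Update

/-- The interpretation of formulas. -/
noncomputable def interp : Formula Ag At → (M : Model.{u, v, w} Ag At) → M.carrier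
  | .atom p, M => M.val p
  | .bot, _ => ⊥
  | .and φ ψ, M => interp φ M ⊓ interp ψ M
  | .or φ ψ, M => interp φ M ⊔ interp ψ M
  | .imp φ ψ, M => interp φ M ⇨ interp ψ M
  | .dia i φ, M => M.dia i (interp φ M)
  | .box i φ, M => M.box i (interp φ M)
  | .evDia F Φ sub e φ, M =>
      preBar M F (fun k => interp (Φ k) M) e ⊓
        PQ.iota _ (interp φ
          (update M F (fun k => interp (Φ k) M) fun e' p => interp (sub e' p) M)) e
  | .evBox F Φ sub e φ, M =>
      preBar M F (fun k => interp (Φ k) M) e ⇨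
        PQ.iota _ (interp φ
          (update M F (fun k => interp (Φ k) M) fun e' p => interp (sub e' p) M)) e
  | .prob i n α φ β, M =>
      (Set.toFinite {a : M.carrier | IsMin (M.dia i) a ∧
        β ≤ ∑ k : Fin n, α k * M.mu i (interp (φ k) M ⊓ a)}).toFinset.sup id

end Model

end IPDEL

/-!
The interpretation of an inequality `t ≥ β` is a join of `i`-minimal elements, and distinct
`i`-minimal elements are disjoint, so such an element lies below the join if and only if `t` takes a
value `≥ β` at it. As the fixed points of `◇ᵢ` are determined by the `i`-minimal elements below
them, the static axioms about probabilities reduce to inequalities between real numbers.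

The `i`-minimal elements of the product algebra are the functions that are equal to some `i`-minimal
`b` on one cell and to `⊥` outside it, and those of the updated algebra are the nonzero classes of
such functions. The elements of `mb(φ)` are pairwise disjoint, so each summand of `μᵢ'` is a
difference `μᵢ(x ⊓ φ) - μᵢ(x ⊓ ⋁ mb(φ))`, which is a premeasure in `x`; below `pre` the sum is
strictly monotone, because two elements `x < y` below `pre(e)` are separated by a `≺`-minimal `φ`
with `y ⊓ φ ≰ x`. Hence `μᵢ'` normalises to a measure and updates preserve APE-models. The reduction
axioms are then computations with representatives below `pre`.

The order and disjointness of `Φ` in the algebra come from derivability, which itself depends on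
event structures being well formed; hence soundness is proved by simultaneous induction on formulas,
event structures and derivations.
-/

namespace IPDEL

section Algebra

namespace IsMonadic

variable {Ag A : Type*} [HeytingAlgebra A] {dia box : Ag → A → A} {i : Ag} {a b x : A}

theorem dia_bot (h : IsMonadic dia box) (i : Ag) : dia i ⊥ = ⊥ := le_bot_iff.1 (h.m8 i)

theorem dia_top (h : IsMonadic dia box) (i : Ag) : dia i ⊤ = ⊤ := top_le_iff.1 (h.m1 i ⊤)

theorem box_top (h : IsMonadic dia box) (i : Ag) : box i ⊤ = ⊤ := top_le_iff.1 (h.m9 i)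

theorem box_dia (h : IsMonadic dia box) (i : Ag) (a : A) : box i (dia i a) = dia i a :=
  le_antisymm (h.m2 i _) (h.m5 i a)

theorem dia_box (h : IsMonadic dia box) (i : Ag) (a : A) : dia i (box i a) = box i a :=
  le_antisymm (h.m6 i a) (h.m1 i _)

theorem dia_dia (h : IsMonadic dia box) (i : Ag) (a : A) : dia i (dia i a) = dia i a := by
  simpa only [h.box_dia] using h.dia_box i (dia i a)

theorem box_eq_self (h : IsMonadic dia box) (ha : dia i a = a) : box i a = a := by
  rw [← ha, h.box_dia]

theorem le_box_iff (h : IsMonadic dia box) (ha : dia i a = a) : a ≤ box i b ↔ a ≤ b :=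
  ⟨fun hab => hab.trans (h.m2 i b), fun hab => (h.box_eq_self ha).ge.trans (h.box_mono i hab)⟩

theorem dia_le_iff (h : IsMonadic dia box) (hb : dia i b = b) : dia i a ≤ b ↔ a ≤ b :=
  ⟨(h.m1 i a).trans, fun hab => (h.dia_mono i hab).trans hb.le⟩

theorem box_inf (h : IsMonadic dia box) (i : Ag) (a b : A) :
    box i (a ⊓ b) = box i a ⊓ box i b :=
  le_antisymm (le_inf (h.box_mono i inf_le_left) (h.box_mono i inf_le_right)) <|
    le_himp_iff.1 ((h.box_mono i (le_himp_iff.2 le_rfl)).trans (h.m4 i b (a ⊓ b)))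

theorem box_inf_dia_le (h : IsMonadic dia box) (i : Ag) (a b : A) :
    box i a ⊓ dia i b ≤ dia i (a ⊓ b) :=
  le_himp_iff.1 ((h.box_mono i (le_himp_iff.2 le_rfl)).trans (h.m7 i b (a ⊓ b)))

theorem dia_sup (h : IsMonadic dia box) (i : Ag) (a b : A) :
    dia i (a ⊔ b) = dia i a ⊔ dia i b :=
  le_antisymm (h.m3 i a b) (sup_le (h.dia_mono i le_sup_left) (h.dia_mono i le_sup_right))

theorem dia_finset_sup (h : IsMonadic dia box) {ι : Type*} (i : Ag) (s : Finset ι) (f : ι → A) :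
    dia i (s.sup f) = s.sup fun k => dia i (f k) :=
  Finset.apply_sup_eq_sup_comp (dia i) (h.dia_sup i) (h.dia_bot i)

theorem dia_inf_eq_self (h : IsMonadic dia box) (ha : dia i a = a) (hb : dia i b = b) :
    dia i (a ⊓ b) = a ⊓ b :=
  le_antisymm (le_inf ((h.dia_le_iff ha).2 inf_le_left) ((h.dia_le_iff hb).2 inf_le_right))
    (h.m1 i _)

theorem dia_compl_eq_self (h : IsMonadic dia box) (ha : dia i a = a) : dia i aᶜ = aᶜ := by
  refine le_antisymm (le_compl_iff_disjoint_left.2 (disjoint_iff_inf_le.2 ?_)) (h.m1 i _)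
  simpa only [h.box_eq_self ha, inf_compl_self, h.dia_bot] using h.box_inf_dia_le i a aᶜ

theorem disjoint_or_le (h : IsMonadic dia box) (ha : IsMin (dia i) a) (hb : dia i b = b) :
    Disjoint a b ∨ a ≤ b := by
  by_cases hab : a ≤ b
  · exact .inr hab
  · exact .inl <| disjoint_iff.2 <|
      ha.2.2 _ (inf_lt_left.2 hab) (h.dia_inf_eq_self ha.2.1 hb)

theorem isMin_eq_of_not_disjoint (h : IsMonadic dia box) (ha : IsMin (dia i) a)
    (hb : IsMin (dia i) b) (hab : ¬ Disjoint a b) : a = b :=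
  le_antisymm ((h.disjoint_or_le ha hb.2.1).resolve_left hab)
    ((h.disjoint_or_le hb ha.2.1).resolve_left fun hba => hab hba.symm)

theorem dia_eq_of_le_isMin (h : IsMonadic dia box) (ha : IsMin (dia i) a) (hxa : x ≤ a)
    (hx : x ≠ ⊥) : dia i x = a := by
  refine le_antisymm ((h.dia_le_iff ha.2.1).2 hxa)
    ((h.disjoint_or_le ha (h.dia_dia i x)).resolve_left fun hd => hx ?_)
  exact disjoint_self.1 (hd.mono hxa (h.m1 i x))

end IsMonadic

theorem exists_isMin_le {A : Type*} [HeytingAlgebra A] [Finite A] {d : A → A} {b : A}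
    (hb : d b = b) (hne : b ≠ ⊥) : ∃ a, IsMin d a ∧ a ≤ b := by
  obtain ⟨a, hab, ha⟩ :=
    exists_minimal_le_of_wellFoundedLT (fun c => c ≠ ⊥ ∧ d c = c) b ⟨hne, hb⟩
  refine ⟨a, ⟨ha.prop.1, ha.prop.2, fun c hc hfix => ?_⟩, hab⟩
  by_contra hcb
  exact hc.not_ge (ha.le_of_le ⟨hcb, hfix⟩ hc.le)

theorem IsMonadic.exists_isMin_not_disjoint {Ag A : Type*} [HeytingAlgebra A] [Finite A]
    {dia box : Ag → A → A} (h : IsMonadic dia box) (i : Ag) {x : A} (hx : x ≠ ⊥) :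
    ∃ a, IsMin (dia i) a ∧ ¬ Disjoint x a := by
  obtain ⟨a, ha, hax⟩ := exists_isMin_le (h.dia_dia i x) (ne_bot_of_le_ne_bot hx (h.m1 i x))
  refine ⟨a, ha, fun hd => ha.1 (disjoint_self.1 ?_)⟩
  have hle : dia i x ≤ aᶜ :=
    (h.dia_le_iff (h.dia_compl_eq_self ha.2.1)).2 (le_compl_iff_disjoint_right.2 hd)
  exact le_compl_iff_disjoint_right.1 (hax.trans hle)

/-- The join of the `i`-minimal elements with the property `Q`, where `d` is `◇ᵢ`: the common
shape of the interpretations of the formulas `t ≥ β`. -/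
noncomputable def minSup {A : Type*} [HeytingAlgebra A] [Finite A] (d : A → A) (Q : A → Prop) :
    A :=
  (Set.toFinite {a | IsMin d a ∧ Q a}).toFinset.sup id

section MinSup

variable {A : Type*} [HeytingAlgebra A] [Finite A] {d : A → A} {Q R : A → Prop} {a p : A}

theorem le_minSup (ha : IsMin d a) (hQ : Q a) : a ≤ minSup d Q :=
  Finset.le_sup (f := id) ((Set.Finite.mem_toFinset _).2 ⟨ha, hQ⟩)

theorem minSup_le (h : ∀ a, IsMin d a → Q a → a ≤ p) : minSup d Q ≤ p :=
  Finset.sup_le fun a ha =>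
    have ha := (Set.Finite.mem_toFinset _).1 ha
    h a ha.1 ha.2

theorem minSup_inf_le (h : ∀ a, IsMin d a → ¬ Disjoint a p → Q a → R a) :
    minSup d Q ⊓ p ≤ minSup d R := by
  rw [← le_himp_iff]
  refine minSup_le fun a ha hQ => le_himp_iff.2 ?_
  by_cases hap : Disjoint a p
  · exact hap.eq_bot.trans_le bot_le
  · exact inf_le_left.trans (le_minSup ha (h a ha hap hQ))

theorem minSup_inf_congr (h : ∀ a, IsMin d a → ¬ Disjoint a p → (Q a ↔ R a)) :
    minSup d Q ⊓ p = minSup d R ⊓ p :=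
  le_antisymm (le_inf (minSup_inf_le fun a ha hap => (h a ha hap).1) inf_le_right)
    (le_inf (minSup_inf_le fun a ha hap => (h a ha hap).2) inf_le_right)

variable {Ag : Type*} {dia box : Ag → A → A}

theorem IsMonadic.dia_minSup (h : IsMonadic dia box) (i : Ag) (Q : A → Prop) :
    dia i (minSup (dia i) Q) = minSup (dia i) Q := by
  refine (h.dia_finset_sup i _ _).trans (Finset.sup_congr rfl fun a ha => ?_)
  exact ((Set.Finite.mem_toFinset _).1 ha).1.2.1

theorem IsMonadic.isMin_le_minSup_iff (h : IsMonadic dia box) {i : Ag} (ha : IsMin (dia i) a) :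
    a ≤ minSup (dia i) Q ↔ Q a := by
  refine ⟨fun hle => ?_, le_minSup ha⟩
  by_contra hQ
  refine ha.1 (le_compl_self.1 (hle.trans (minSup_le fun b hb hQb => ?_)))
  refine le_compl_iff_disjoint_right.2 (not_not.1 fun hba => hQ ?_)
  rwa [← h.isMin_eq_of_not_disjoint hb ha hba]

end MinSup

namespace IsEpistemic

variable {Ag A : Type*} [HeytingAlgebra A] {dia box : Ag → A → A} {i : Ag} {x y : A}

theorem minSup_true [Finite A] (h : IsEpistemic dia box) (i : Ag) :
    minSup (dia i) (fun _ => True) = ⊤ := by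
  set t := minSup (dia i) fun _ => True
  have hfix : dia i t = t := h.dia_minSup i _
  have hcompl : tᶜ = ⊥ := by
    by_contra hne
    obtain ⟨a, ha, hle⟩ := exists_isMin_le (h.dia_compl_eq_self hfix) hne
    exact ha.1 (disjoint_self.1 ((le_compl_iff_disjoint_right.1 hle).mono_right
      (le_minSup ha trivial)))
  simpa only [hfix, hcompl, sup_bot_eq] using h.e i t

theorem le_of_forall_isMin_le (h : IsEpistemic dia box) (hx : dia i x = x)
    (hxy : ∀ a, IsMin (dia i) a → a ≤ x → a ≤ y) : x ≤ y := by
  have := h.finite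
  rw [← himp_eq_top_iff, ← top_le_iff, ← h.minSup_true i]
  refine minSup_le fun a ha _ => le_himp_iff.2 ?_
  rcases h.disjoint_or_le ha hx with hd | hle
  · exact hd.eq_bot.trans_le bot_le
  · exact inf_le_left.trans (hxy a ha hle)

theorem eq_of_forall_isMin_le_iff (h : IsEpistemic dia box) (hx : dia i x = x)
    (hy : dia i y = y) (hxy : ∀ a, IsMin (dia i) a → (a ≤ x ↔ a ≤ y)) : x = y :=
  le_antisymm (h.le_of_forall_isMin_le hx fun a ha => (hxy a ha).1)
    (h.le_of_forall_isMin_le hy fun a ha => (hxy a ha).2)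

theorem eq_top_of_forall_isMin_le (h : IsEpistemic dia box)
    (hy : ∀ a, IsMin (dia i) a → a ≤ y) : y = ⊤ :=
  top_le_iff.1 (h.le_of_forall_isMin_le (h.dia_top i) fun a ha _ => hy a ha)

end IsEpistemic

namespace IsPremeasure

variable {A : Type*} [HeytingAlgebra A] {d : A → A} {μ : A → ℝ} {a : A}

theorem bot_eq_zero (h : IsPremeasure d μ) (ha : IsMin d a) : μ ⊥ = 0 := h.bot ⟨a, ha⟩

theorem of_mono (mono : ∀ a, IsMin d a → ∀ b c, b ≤ c → c ≤ a → μ b ≤ μ c)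
    (join : ∀ a, IsMin d a → ∀ b c, b ≤ a → c ≤ a → μ (b ⊔ c) = μ b + μ c - μ (b ⊓ c))
    (bot : (∃ a, IsMin d a) → μ ⊥ = 0) : IsPremeasure d μ where
  nonneg a ha b hb := (bot ⟨a, ha⟩).ge.trans (mono a ha ⊥ b bot_le hb)
  mono := mono
  join := join
  bot := bot

theorem finset_sup (h : IsPremeasure d μ) (ha : IsMin d a) {ι : Type*} (s : Finset ι)
    (f : ι → A) (hf : ∀ k ∈ s, f k ≤ a) (hd : (s : Set ι).PairwiseDisjoint f) :
    μ (s.sup f) = ∑ k ∈ s, μ (f k) := by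
  classical
  induction s using Finset.induction_on with
  | empty => simpa only [Finset.sup_empty, Finset.sum_empty] using h.bot_eq_zero ha
  | insert k s hk ih =>
    simp only [Finset.mem_insert, forall_eq_or_imp] at hf
    rw [Finset.coe_insert] at hd
    have hdis : Disjoint (f k) (s.sup f) := Finset.disjoint_sup_right.2 fun l hl =>
      hd (Set.mem_insert k _) (Set.mem_insert_of_mem k hl) (ne_of_mem_of_not_mem hl hk).symm
    rw [Finset.sup_insert, Finset.sum_insert hk, h.join a ha _ _ hf.1 (Finset.sup_le hf.2),
      hdis.eq_bot, h.bot_eq_zero ha, sub_zero, ih hf.2 (hd.subset (Set.subset_insert k _))]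

theorem congr {ν : A → ℝ} (h : IsPremeasure d μ)
    (hν : ∀ a, IsMin d a → ∀ x, x ≤ a → ν x = μ x) : IsPremeasure d ν where
  nonneg a ha b hb := (h.nonneg a ha b hb).trans_eq (hν a ha b hb).symm
  mono a ha b c hbc hc := by
    simpa only [hν a ha b (hbc.trans hc), hν a ha c hc] using h.mono a ha b c hbc hc
  join a ha b c hb hc := by
    rw [hν a ha _ (sup_le hb hc), hν a ha b hb, hν a ha c hc, hν a ha _ (inf_le_left.trans hb)]
    exact h.join a ha b c hb hc
  bot := fun ⟨a, ha⟩ => (hν a ha ⊥ bot_le).trans (h.bot_eq_zero ha)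

theorem sub_inf (h : IsPremeasure d μ) {s p : A} (hsp : s ≤ p) :
    IsPremeasure d fun x => μ (x ⊓ p) - μ (x ⊓ s) := by
  refine of_mono (fun a ha b c hbc hc => ?_) (fun a ha b c hb hc => ?_) fun _ => ?_
  · have hle : b ⊓ p ⊔ c ⊓ s ≤ c ⊓ p := sup_le (inf_le_inf_right p hbc) (inf_le_inf_left c hsp)
    have hinf : b ⊓ p ⊓ (c ⊓ s) = b ⊓ s := by
      rw [inf_inf_inf_comm, inf_eq_left.2 hbc, inf_eq_right.2 hsp]
    have hjoin := h.join a ha (b ⊓ p) (c ⊓ s) (inf_le_left.trans (hbc.trans hc))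
      (inf_le_left.trans hc)
    have hmono := h.mono a ha _ _ hle (inf_le_left.trans hc)
    rw [hinf] at hjoin
    linarith
  · have hjoin (z : A) := h.join a ha (b ⊓ z) (c ⊓ z) (inf_le_left.trans hb)
      (inf_le_left.trans hc)
    simp only [← inf_sup_right, ← inf_inf_distrib_right] at hjoin
    rw [hjoin p, hjoin s]
    ring
  · simp only [bot_inf_eq, sub_self]

theorem const_mul (h : IsPremeasure d μ) {r : ℝ} (hr : 0 ≤ r) :
    IsPremeasure d fun x => r * μ x where
  nonneg a ha b hb := mul_nonneg hr (h.nonneg a ha b hb)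
  mono a ha b c hbc hc := mul_le_mul_of_nonneg_left (h.mono a ha b c hbc hc) hr
  join a ha b c hb hc := by rw [h.join a ha b c hb hc]; ring
  bot hex := by rw [h.bot hex, mul_zero]

theorem sum {ι : Type*} {s : Finset ι} {ν : ι → A → ℝ} (h : ∀ k ∈ s, IsPremeasure d (ν k)) :
    IsPremeasure d fun x => ∑ k ∈ s, ν k x where
  nonneg a ha b hb := Finset.sum_nonneg fun k hk => (h k hk).nonneg a ha b hb
  mono a ha b c hbc hc := Finset.sum_le_sum fun k hk => (h k hk).mono a ha b c hbc hc
  join a ha b c hb hc := by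
    rw [← Finset.sum_add_distrib, ← Finset.sum_sub_distrib]
    exact Finset.sum_congr rfl fun k hk => (h k hk).join a ha b c hb hc
  bot hex := Finset.sum_eq_zero fun k hk => (h k hk).bot hex

end IsPremeasure

theorem IsMeasure.eq_iff {A : Type*} [HeytingAlgebra A] {d : A → A} {μ : A → ℝ} {a b c : A}
    (h : IsMeasure d μ) (ha : IsMin d a) (hbc : b ≤ c) (hca : c ≤ a) : μ b = μ c ↔ b = c :=
  ⟨fun heq => hbc.eq_of_not_lt fun hlt => (h.strict a ha b c hlt hca).ne heq,
    fun heq => heq ▸ rfl⟩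

theorem IsPremeasure.isMeasure_of_eq_div {A : Type*} [HeytingAlgebra A] {d : A → A}
    {μ ν : A → ℝ} (hν : IsPremeasure d ν)
    (strict : ∀ a, IsMin d a → ∀ b c, b < c → c ≤ a → ν b < ν c)
    (hμ : ∀ a, IsMin d a → ∀ x, x ≤ a → μ x = ν x / ν a) : IsMeasure d μ := by
  have pos (a : A) (ha : IsMin d a) : 0 < ν a :=
    (hν.bot_eq_zero ha).symm.trans_lt (strict a ha ⊥ a (bot_lt_iff_ne_bot.2 ha.1) le_rfl)
  refine ⟨.of_mono (fun a ha b c hbc hc => ?_) (fun a ha b c hb hc => ?_) fun ⟨a, ha⟩ => ?_,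
    fun a ha b c hbc hc => ?_, fun a ha => ?_⟩
  · rw [hμ a ha b (hbc.trans hc), hμ a ha c hc]
    exact div_le_div_of_nonneg_right (hν.mono a ha b c hbc hc) (pos a ha).le
  · rw [hμ a ha _ (sup_le hb hc), hμ a ha b hb, hμ a ha c hc, hμ a ha _ (inf_le_left.trans hb),
      hν.join a ha b c hb hc, sub_div, add_div]
  · rw [hμ a ha ⊥ bot_le, hν.bot_eq_zero ha, zero_div]
  · rw [hμ a ha b (hbc.le.trans hc), hμ a ha c hc]
    exact div_lt_div_of_pos_right (strict a ha b c hbc hc) (pos a ha)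
  · rw [hμ a ha a le_rfl, div_self (pos a ha).ne']

namespace PQ

variable {A : Type*} [HeytingAlgebra A] {a b : A} {q r : PQ a}

theorem iota_bot : iota a (⊥ : PQ a) = ⊥ := bot_inf_eq a

theorem iota_top : iota a (⊤ : PQ a) = a := top_inf_eq a

theorem iota_inf (q r : PQ a) : iota a (q ⊓ r) = iota a q ⊓ iota a r :=
  inf_eq_left.2 (inf_le_left.trans (iota_le a q))

theorem iota_sup (q r : PQ a) : iota a (q ⊔ r) = iota a q ⊔ iota a r :=
  inf_eq_left.2 (sup_le (iota_le a q) (iota_le a r))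

theorem iota_compl (q : PQ a) : iota a qᶜ = (iota a q)ᶜ ⊓ a := rfl

theorem iota_eq_bot : iota a q = ⊥ ↔ q = ⊥ :=
  ⟨fun h => iota_inj (h.trans iota_bot.symm), fun h => h ▸ iota_bot⟩

theorem iota_le_iota : iota a q ≤ iota a r ↔ q ≤ r := Iff.rfl

theorem iota_lt_iota : iota a q < iota a r ↔ q < r := by
  rw [lt_iff_le_not_ge, lt_iff_le_not_ge, iota_le_iota, iota_le_iota]

theorem iota_dia (d : A → A) (q : PQ a) : iota a (dia a d q) = d (iota a q) ⊓ a := by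
  induction q using Quotient.ind with
  | _ b => rfl

theorem iota_box (bx : A → A) (q : PQ a) : iota a (box a bx q) = bx (a ⇨ iota a q) ⊓ a := by
  induction q using Quotient.ind with
  | _ b =>
    change bx (a ⇨ b) ⊓ a = bx (a ⇨ b ⊓ a) ⊓ a
    rw [himp_inf_distrib, himp_self, inf_top_eq]

theorem disjoint_iota : Disjoint (iota a q) (iota a r) ↔ Disjoint q r := by
  rw [disjoint_iff, disjoint_iff, ← iota_inf, iota_eq_bot]

theorem mk_eq_bot : mk a b = ⊥ ↔ Disjoint b a := by
  rw [← iota_eq_bot, iota_mk, disjoint_iff]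

variable {Ag : Type*} {d bx : Ag → A → A}

theorem isMonadic (h : IsMonadic d bx) (a : A) :
    IsMonadic (fun i => PQ.dia a (d i)) (fun i => PQ.box a (bx i)) where
  dia_mono i q r hqr := by
    rw [← iota_le_iota, iota_dia, iota_dia]
    exact inf_le_inf_right a (h.dia_mono i hqr)
  box_mono i q r hqr := by
    rw [← iota_le_iota, iota_box, iota_box]
    exact inf_le_inf_right a (h.box_mono i (himp_le_himp_left hqr))
  m1 i q := by
    rw [← iota_le_iota, iota_dia]
    exact le_inf (h.m1 i _) (iota_le a q)
  m2 i q := by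
    rw [← iota_le_iota, iota_box]
    exact (inf_le_inf_right a (h.m2 i _)).trans himp_inf_le
  m3 i q r := by
    rw [← iota_le_iota, iota_sup, iota_dia, iota_dia, iota_dia, iota_sup, ← inf_sup_right]
    exact inf_le_inf_right a (h.m3 i _ _)
  m4 i q r := by
    rw [le_himp_iff, ← iota_le_iota, iota_inf, iota_box, iota_box, iota_box,
      ← inf_inf_distrib_right, ← h.box_inf, ← himp_inf_distrib, ← iota_inf]
    exact inf_le_inf_right a (h.box_mono i (himp_le_himp_left (iota_le_iota.2 himp_inf_le)))
  m5 i q := by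
    rw [← iota_le_iota, iota_box, iota_dia, himp_inf_distrib, himp_self, inf_top_eq]
    exact inf_le_inf_right a ((h.m5 i _).trans (h.box_mono i le_himp))
  m6 i q := by
    rw [← iota_le_iota, iota_dia, iota_box]
    exact inf_le_inf_right a ((h.dia_mono i inf_le_left).trans (h.m6 i _))
  m7 i q r := by
    rw [le_himp_iff, ← iota_le_iota, iota_inf, iota_box, iota_dia, iota_dia,
      ← inf_inf_distrib_right]
    refine inf_le_inf_right a ((h.box_inf_dia_le i _ _).trans (h.dia_mono i ?_))
    calc (a ⇨ iota a (q ⇨ r)) ⊓ iota a q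
        ≤ iota a (q ⇨ r) ⊓ iota a q :=
          le_inf ((inf_le_inf_left _ (iota_le a q)).trans himp_inf_le) inf_le_right
      _ ≤ iota a r := (iota_inf _ _).ge.trans (iota_le_iota.2 himp_inf_le)
  m8 i := by rw [← iota_le_iota, iota_dia, iota_bot, h.dia_bot, bot_inf_eq]
  m9 i := by rw [← iota_le_iota, iota_box, iota_top, himp_self, h.box_top, top_inf_eq]

theorem isEpistemic (h : IsEpistemic d bx) (a : A) :
    IsEpistemic (fun i => PQ.dia a (d i)) (fun i => PQ.box a (bx i)) where
  toIsMonadic := isMonadic h.toIsMonadic a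
  finite := have := h.finite; inferInstance
  e i q := by
    rw [← top_le_iff, ← iota_le_iota, iota_sup, iota_compl, iota_dia, iota_top]
    calc a = (d i (iota a q) ⊔ (d i (iota a q))ᶜ) ⊓ a := by rw [h.e, top_inf_eq]
      _ = d i (iota a q) ⊓ a ⊔ (d i (iota a q))ᶜ ⊓ a := inf_sup_right _ _ _
      _ ≤ _ := sup_le_sup_left (inf_le_inf_right a (compl_anti inf_le_left)) _

theorem isMin_mk {i : Ag} (h : IsMonadic d bx) (hb : IsMin (d i) b) (hba : ¬ Disjoint b a) :
    IsMin (PQ.dia a (d i)) (mk a b) := by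
  have hne : mk a b ≠ ⊥ := mk_eq_bot.not.2 hba
  refine ⟨hne, iota_inj ?_, fun q hq hfix => ?_⟩
  · rw [iota_dia, iota_mk, h.dia_eq_of_le_isMin hb inf_le_left fun h0 => hba (disjoint_iff.2 h0)]
  · by_contra hq0
    have hdia : d i (iota a q) = b :=
      h.dia_eq_of_le_isMin hb ((iota_le_iota.2 hq.le).trans inf_le_left) (iota_eq_bot.not.2 hq0)
    refine hq.ne (iota_inj ?_)
    rw [← hfix, iota_dia, hdia, iota_mk]

theorem exists_isMin_eq_mk [Finite A] {i : Ag} (h : IsMonadic d bx)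
    (hq : IsMin (PQ.dia a (d i)) q) : ∃ b, IsMin (d i) b ∧ ¬ Disjoint b a ∧ q = mk a b := by
  obtain ⟨b, hb, hqb⟩ := h.exists_isMin_not_disjoint i (iota_eq_bot.not.2 hq.1)
  have hba : ¬ Disjoint b a := fun hd => hqb (hd.symm.mono_left (iota_le a q))
  refine ⟨b, hb, hba, (isMonadic h a).isMin_eq_of_not_disjoint hq (isMin_mk h hb hba) fun hd => ?_⟩
  rw [← disjoint_iota, disjoint_iff, iota_mk, inf_comm b, ← inf_assoc,
    inf_eq_left.2 (iota_le a q)] at hd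
  exact hqb (disjoint_iff.2 hd)

theorem iota_minSup [Finite A] (h : IsMonadic d bx) (i : Ag) (Q : PQ a → Prop) :
    iota a (minSup (PQ.dia a (d i)) Q) = minSup (d i) (fun b => Q (mk a b)) ⊓ a := by
  refine le_antisymm (le_inf ?_ (iota_le a _)) ?_
  · have hle : minSup (PQ.dia a (d i)) Q ≤ mk a (minSup (d i) fun b => Q (mk a b)) := by
      refine minSup_le fun q hq hQ => ?_
      obtain ⟨b, hb, -, rfl⟩ := exists_isMin_eq_mk h hq
      exact inf_le_inf_right a (le_minSup hb hQ)
    exact (iota_le_iota.2 hle).trans inf_le_left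
  · rw [← le_himp_iff]
    refine minSup_le fun b hb hQ => le_himp_iff.2 ?_
    by_cases hba : Disjoint b a
    · exact hba.eq_bot.trans_le bot_le
    · exact iota_le_iota.2 (le_minSup (isMin_mk h hb hba) hQ)

theorem isPremeasure_comp_iota [Finite A] {i : Ag} {μ : A → ℝ} (h : IsMonadic d bx)
    (hμ : IsPremeasure (d i) μ) : IsPremeasure (PQ.dia a (d i)) fun q => μ (iota a q) := by
  have bound {q : PQ a} (hq : IsMin (PQ.dia a (d i)) q) :
      ∃ b, IsMin (d i) b ∧ ∀ r ≤ q, iota a r ≤ b := by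
    obtain ⟨b, hb, -, rfl⟩ := exists_isMin_eq_mk h hq
    exact ⟨b, hb, fun r hr => (iota_le_iota.2 hr).trans inf_le_left⟩
  refine .of_mono (fun q hq r s hrs hs => ?_) (fun q hq r s hr hs => ?_) fun ⟨q, hq⟩ => ?_
  all_goals obtain ⟨b, hb, hle⟩ := bound hq
  · exact hμ.mono b hb _ _ (iota_le_iota.2 hrs) (hle s hs)
  · rw [iota_sup, iota_inf]
    exact hμ.join b hb _ _ (hle r hr) (hle s hs)
  · rw [iota_bot, hμ.bot_eq_zero hb]

end PQ

end Algebra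

section Update

namespace EventFrame

variable {Ag A : Type*} {F : EventFrame Ag} {i : Ag} {e e' : Fin F.n} {b : A}

/-- The function with the value `b` on the cell of `e` and `⊥` elsewhere. For `i`-minimal `b` these
are the `i`-minimal elements of the product algebra. -/
noncomputable def cellFun [Bot A] (F : EventFrame Ag) (i : Ag) (e : Fin F.n) (b : A) :
    Fin F.n → A :=
  open scoped Classical in
  fun e' => if F.rel i e' e then b else ⊥

theorem cellFun_of_rel [Bot A] (h : F.rel i e' e) : F.cellFun i e b e' = b := if_pos h

theorem cellFun_of_not_rel [Bot A] (h : ¬ F.rel i e' e) : F.cellFun i e b e' = ⊥ := if_neg h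

theorem cellFun_self [Bot A] : F.cellFun i e b e = b := cellFun_of_rel ((F.rel_equiv i).refl e)

theorem cellFun_le [HeytingAlgebra A] (e' : Fin F.n) : F.cellFun i e b e' ≤ b := by
  by_cases h : F.rel i e' e
  · exact (cellFun_of_rel h).le
  · exact (cellFun_of_not_rel h).trans_le bot_le

theorem not_disjoint_cellFun [HeytingAlgebra A] {f : Fin F.n → A} (h : ¬ Disjoint b (f e)) :
    ¬ Disjoint (F.cellFun i e b) f := fun hd =>
  h (cellFun_self (i := i) (b := b) ▸ Pi.disjoint_iff.1 hd e)

theorem mem_mb {k l : Fin F.m} :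
    l ∈ F.mb k ↔ F.prec l k ∧ ∀ o, F.prec o k → ¬ F.prec l o := by
  simp only [mb, Finset.mem_filter_univ]

/-- The conditions that the interpretations `Φ k` of the formulas of an event structure inherit
from derivability. -/
structure IsCoherent [HeytingAlgebra A] (F : EventFrame Ag) (Φ : Fin F.m → A) : Prop where
  le : ∀ k l, F.prec k l → Φ k ≤ Φ l
  disjoint : ∀ k l, k ≠ l → ¬ F.prec k l → ¬ F.prec l k → Disjoint (Φ k) (Φ l)

namespace IsCoherent

variable [HeytingAlgebra A] {Φ : Fin F.m → A}

theorem sup_mb_le (h : F.IsCoherent Φ) (k : Fin F.m) : (F.mb k).sup Φ ≤ Φ k :=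
  Finset.sup_le fun l hl => h.le l k (mem_mb.1 hl).1

theorem pairwiseDisjoint_mb (h : F.IsCoherent Φ) (k : Fin F.m) :
    (F.mb k : Set (Fin F.m)).PairwiseDisjoint Φ := fun l hl o ho hlo =>
  h.disjoint l o hlo ((mem_mb.1 hl).2 o (mem_mb.1 ho).1) ((mem_mb.1 ho).2 l (mem_mb.1 hl).1)

end IsCoherent

end EventFrame

namespace Model

open EventFrame

variable {Ag : Type u} {At : Type v} {M : Model.{u, v, w} Ag At} {F : EventFrame Ag} {i : Ag}
  {e e' : Fin F.n} {b c : M.carrier} {f g : Fin F.n → M.carrier}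

theorem prodDia_le_iff : prodDia M F i f e ≤ c ↔ ∀ e', F.rel i e' e → M.dia i (f e') ≤ c := by
  simp only [prodDia, Finset.sup_le_iff, Finset.mem_filter_univ]

theorem dia_le_prodDia (he : F.rel i e' e) (f : Fin F.n → M.carrier) :
    M.dia i (f e') ≤ prodDia M F i f e :=
  prodDia_le_iff.1 le_rfl e' he

theorem le_prodBox_iff : c ≤ prodBox M F i f e ↔ ∀ e', F.rel i e' e → c ≤ M.box i (f e') := by
  simp only [prodBox, Finset.le_inf_iff, Finset.mem_filter_univ]

theorem prodBox_le_box (he : F.rel i e' e) (f : Fin F.n → M.carrier) :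
    prodBox M F i f e ≤ M.box i (f e') :=
  le_prodBox_iff.1 le_rfl e' he

theorem isMonadic_prod (h : IsMonadic M.dia M.box) (F : EventFrame Ag) :
    IsMonadic (prodDia M F) (prodBox M F) where
  dia_mono i _ g hfg _ := prodDia_le_iff.2 fun e' he =>
    (h.dia_mono i (hfg e')).trans (dia_le_prodDia he g)
  box_mono i f _ hfg _ := le_prodBox_iff.2 fun e' he =>
    (prodBox_le_box he f).trans (h.box_mono i (hfg e'))
  m1 i f e := (h.m1 i _).trans (dia_le_prodDia ((F.rel_equiv i).refl e) f)
  m2 i f e := (prodBox_le_box ((F.rel_equiv i).refl e) f).trans (h.m2 i _)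
  m3 i f g _ := prodDia_le_iff.2 fun _ he => (h.m3 i _ _).trans
    (sup_le_sup (dia_le_prodDia he f) (dia_le_prodDia he g))
  m4 i f _ _ := le_himp_iff.2 <| le_prodBox_iff.2 fun _ he =>
    (inf_le_inf (prodBox_le_box he _) (prodBox_le_box he f)).trans (le_himp_iff.1 (h.m4 i _ _))
  m5 i f _ := prodDia_le_iff.2 fun _ he => le_prodBox_iff.2 fun _ he' =>
    (h.m5 i _).trans (h.box_mono i
      (dia_le_prodDia ((F.rel_equiv i).trans he ((F.rel_equiv i).symm he')) f))
  m6 i f _ := prodDia_le_iff.2 fun _ he => le_prodBox_iff.2 fun _ he' =>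
    (h.dia_mono i (prodBox_le_box
      ((F.rel_equiv i).trans he' ((F.rel_equiv i).symm he)) f)).trans (h.m6 i _)
  m7 i _ g _ := le_himp_comm.2 <| prodDia_le_iff.2 fun _ he => le_himp_comm.2 <|
    (prodBox_le_box he _).trans
      ((h.m7 i _ _).trans (himp_le_himp_left (dia_le_prodDia he g)))
  m8 i _ := prodDia_le_iff.2 fun _ _ => h.m8 i
  m9 i _ := le_prodBox_iff.2 fun _ _ => h.m9 i

theorem isEpistemic_prod (h : IsEpistemic M.dia M.box) (F : EventFrame Ag) :
    IsEpistemic (prodDia M F) (prodBox M F) where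
  toIsMonadic := isMonadic_prod h.toIsMonadic F
  finite := inferInstance
  e i f := by
    funext e
    have hfix : M.dia i (prodDia M F i f e) = prodDia M F i f e :=
      (h.dia_finset_sup i _ _).trans (Finset.sup_congr rfl fun e' _ => h.dia_dia i (f e'))
    have := h.e i (prodDia M F i f e)
    rwa [hfix] at this

theorem prodDia_cellFun (h : IsMonadic M.dia M.box) (hb : M.dia i b = b) (e : Fin F.n) :
    prodDia M F i (F.cellFun i e b) = F.cellFun i e b := by
  refine le_antisymm (fun e' => prodDia_le_iff.2 fun e'' he => ?_)
    ((isMonadic_prod h F).m1 i _)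
  by_cases he' : F.rel i e' e
  · exact ((h.dia_le_iff hb).2 (cellFun_le e'')).trans_eq (cellFun_of_rel he').symm
  · have he'' : ¬ F.rel i e'' e := fun hr =>
      he' ((F.rel_equiv i).trans ((F.rel_equiv i).symm he) hr)
    rw [cellFun_of_not_rel he'', h.dia_bot]
    exact bot_le

theorem isMin_cellFun (h : IsMonadic M.dia M.box) (hb : IsMin (M.dia i) b) (e : Fin F.n) :
    IsMin (prodDia M F i) (F.cellFun i e b) := by
  refine ⟨fun h0 => hb.1 (cellFun_self.symm.trans (congrFun h0 e)),
    prodDia_cellFun h hb.2.1 e, fun f hf hfix => ?_⟩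
  by_contra hne
  obtain ⟨e', he'⟩ := Function.ne_iff.1 hne
  have hrel : F.rel i e' e := by
    by_contra hn
    exact he' (le_bot_iff.1 ((hf.le e').trans_eq (cellFun_of_not_rel hn)))
  have hdia : M.dia i (f e') = b :=
    h.dia_eq_of_le_isMin hb ((hf.le e').trans (cellFun_le e')) he'
  refine hf.not_ge fun e'' => ?_
  by_cases hrel' : F.rel i e'' e
  · rw [cellFun_of_rel hrel', ← hdia, ← hfix]
    exact hfix.symm ▸ dia_le_prodDia ((F.rel_equiv i).trans hrel ((F.rel_equiv i).symm hrel')) f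
  · exact (cellFun_of_not_rel hrel').trans_le bot_le

theorem exists_isMin_eq_cellFun (h : IsMonadic M.dia M.box) (hf : IsMin (prodDia M F i) f)
    (he : f e ≠ ⊥) : ∃ b, IsMin (M.dia i) b ∧ f = F.cellFun i e b := by
  obtain ⟨b, hb, hfb⟩ := h.exists_isMin_not_disjoint i he
  refine ⟨b, hb, (isMonadic_prod h F).isMin_eq_of_not_disjoint hf (isMin_cellFun h hb e) ?_⟩
  intro hd
  have hde := Pi.disjoint_iff.1 hd e
  rw [cellFun_self] at hde
  exact hfb hde

theorem minSup_prodDia_apply (h : IsMonadic M.dia M.box) (i : Ag)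
    (Q : (Fin F.n → M.carrier) → Prop) (e : Fin F.n) :
    minSup (prodDia M F i) Q e = minSup (M.dia i) fun b => Q (F.cellFun i e b) := by
  refine le_antisymm ?_ (minSup_le fun b hb hQ => ?_)
  · set p := minSup (M.dia i) fun b => Q (F.cellFun i e b)
    have hle : minSup (prodDia M F i) Q ≤ Function.update ⊤ e p := by
      refine minSup_le fun f hf hQ => le_update_iff.2 ⟨?_, fun _ _ => le_top⟩
      by_cases he : f e = ⊥
      · exact he.trans_le bot_le
      · obtain ⟨b, hb, rfl⟩ := exists_isMin_eq_cellFun h hf he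
        exact cellFun_self.trans_le (le_minSup hb hQ)
    exact (le_update_iff.1 hle).1
  · exact cellFun_self.symm.trans_le (le_minSup (isMin_cellFun h hb e) hQ e)

theorem isPremeasure_comp_eval {μ : M.carrier → ℝ} (h : IsMonadic M.dia M.box)
    (hμ : IsPremeasure (M.dia i) μ) (e : Fin F.n) :
    IsPremeasure (prodDia M F i) fun f => μ (f e) := by
  have bound {f : Fin F.n → M.carrier} (hf : IsMin (prodDia M F i) f) :
      ∃ b, IsMin (M.dia i) b ∧ ∀ e, f e ≤ b := by
    obtain ⟨e', he'⟩ := Function.ne_iff.1 hf.1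
    obtain ⟨b, hb, rfl⟩ := exists_isMin_eq_cellFun h hf he'
    exact ⟨b, hb, cellFun_le⟩
  refine .of_mono (fun f hf g k hgk hk => ?_) (fun f hf g k hg hk => ?_) fun ⟨f, hf⟩ => ?_
  all_goals obtain ⟨b, hb, hle⟩ := bound hf
  · exact hμ.mono b hb _ _ (hgk e) ((hk e).trans (hle e))
  · exact hμ.join b hb _ _ ((hg e).trans (hle e)) ((hk e).trans (hle e))
  · exact hμ.bot_eq_zero hb

variable {Φ : Fin F.m → M.carrier} {k : Fin F.m} {x y : M.carrier}

theorem le_preBar (h : F.pre e k ≠ 0) : Φ k ≤ preBar M F Φ e :=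
  Finset.le_sup (f := Φ) ((Finset.mem_filter_univ k).2 h)

theorem preBar_le_iff : preBar M F Φ e ≤ c ↔ ∀ k, F.pre e k ≠ 0 → Φ k ≤ c := by
  simp only [preBar, Finset.sup_le_iff, Finset.mem_filter_univ]

theorem isPremeasure_muPart (hμ : IsPremeasure (M.dia i) (M.mu i)) (hΦ : F.IsCoherent Φ)
    (k : Fin F.m) : IsPremeasure (M.dia i) (muPart M F Φ i k) :=
  (hμ.sub_inf (hΦ.sup_mb_le k)).congr fun a ha x hx => by
    have hd : (F.mb k : Set (Fin F.m)).PairwiseDisjoint fun l => x ⊓ Φ l :=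
      (hΦ.pairwiseDisjoint_mb k).mono fun _ => inf_le_right
    rw [muPart, Finset.sup_inf_distrib_left, hμ.finset_sup ha _ _ (fun l _ => inf_le_of_left_le hx)
      hd]

theorem isPremeasure_muProd (h : IsMonadic M.dia M.box) (hμ : IsPremeasure (M.dia i) (M.mu i))
    (hΦ : F.IsCoherent Φ) : IsPremeasure (prodDia M F i) (muProd M F Φ i) := by
  have hterm (e : Fin F.n) (k : Fin F.m) := (isPremeasure_comp_eval h
    (isPremeasure_muPart hμ hΦ k) e).const_mul (mul_nonneg (F.P_pos i e).le (F.pre_nonneg e k))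
  refine (IsPremeasure.sum (s := .univ) fun e _ =>
    IsPremeasure.sum (s := .univ) fun k _ => hterm e k).congr fun _ _ _ _ => ?_
  simp only [muProd, mul_right_comm]

theorem exists_minimal_not_inf_le (hxy : x < y) (hy : y ≤ preBar M F Φ e) :
    ∃ k, F.pre e k ≠ 0 ∧ ¬ y ⊓ Φ k ≤ x ∧ ∀ l, F.prec l k → y ⊓ Φ l ≤ x := by
  have hex : ∃ k, F.pre e k ≠ 0 ∧ ¬ y ⊓ Φ k ≤ x := by
    by_contra! hn
    have hle : preBar M F Φ e ≤ y ⇨ x := preBar_le_iff.2 fun k hk => le_himp_iff'.2 (hn k hk)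
    exact hxy.not_ge (le_himp_iff_left.1 (hy.trans hle))
  have : IsTrans (Fin F.m) F.prec := ⟨F.prec_trans⟩
  have : Std.Irrefl F.prec := ⟨F.prec_irrefl⟩
  obtain ⟨k, ⟨hk, hlt⟩, hmin⟩ := (Finite.wellFounded_of_trans_of_irrefl F.prec).has_min
    {k | F.pre e k ≠ 0 ∧ ¬ y ⊓ Φ k ≤ x} hex
  refine ⟨k, hk, hlt, fun l hlk => ?_⟩
  by_contra hl
  exact hmin l ⟨fun h0 => hk (F.compat e l k hlk h0), hl⟩ hlk

theorem exists_muPart_lt (hμ : IsMeasure (M.dia i) (M.mu i)) (hb : IsMin (M.dia i) b)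
    (hxy : x < y) (hyb : y ≤ b) (hy : y ≤ preBar M F Φ e) :
    ∃ k, F.pre e k ≠ 0 ∧ muPart M F Φ i k x < muPart M F Φ i k y := by
  obtain ⟨k, hk, hlt, hmin⟩ := exists_minimal_not_inf_le hxy hy
  have hmb (l : Fin F.m) (hl : l ∈ F.mb k) : x ⊓ Φ l = y ⊓ Φ l :=
    le_antisymm (inf_le_inf_right _ hxy.le) (le_inf (hmin l (mem_mb.1 hl).1) inf_le_right)
  refine ⟨k, hk, ?_⟩
  rw [muPart, muPart, Finset.sum_congr rfl fun l hl => congrArg (M.mu i) (hmb l hl)]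
  refine sub_lt_sub_right (hμ.strict b hb _ _ ?_ (inf_le_of_left_le hyb)) _
  exact (inf_le_inf_right _ hxy.le).lt_of_ne fun heq => hlt (heq ▸ inf_le_left)

theorem muProd_lt_muProd (h : IsMonadic M.dia M.box) (hμ : IsMeasure (M.dia i) (M.mu i))
    (hΦ : F.IsCoherent Φ) {c : Fin F.n → M.carrier} (hc : IsMin (prodDia M F i) c) (hfg : f < g)
    (hgc : g ≤ c) (hg : g ≤ preBar M F Φ) : muProd M F Φ i f < muProd M F Φ i g := by
  obtain ⟨hle, e, he⟩ := Pi.lt_def.1 hfg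
  obtain ⟨e', he'⟩ := Function.ne_iff.1 hc.1
  obtain ⟨b, hb, rfl⟩ := exists_isMin_eq_cellFun h hc he'
  have hgb (e : Fin F.n) : g e ≤ b := (hgc e).trans (cellFun_le e)
  obtain ⟨k, hk, hlt⟩ := exists_muPart_lt hμ hb he (hgb e) (hg e)
  have hterm (e : Fin F.n) (k : Fin F.m) : F.P i e * muPart M F Φ i k (f e) * F.pre e k ≤
      F.P i e * muPart M F Φ i k (g e) * F.pre e k :=
    mul_le_mul_of_nonneg_right (mul_le_mul_of_nonneg_left
      ((isPremeasure_muPart hμ.toIsPremeasure hΦ k).mono b hb _ _ (hle e) (hgb e))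
      (F.P_pos i e).le) (F.pre_nonneg e k)
  refine Finset.sum_lt_sum (fun e _ => Finset.sum_le_sum fun k _ => hterm e k)
    ⟨e, Finset.mem_univ e, Finset.sum_lt_sum (fun k _ => hterm e k) ⟨k, Finset.mem_univ k, ?_⟩⟩
  exact mul_lt_mul_of_pos_right (mul_lt_mul_of_pos_left hlt (F.P_pos i e))
    ((F.pre_nonneg e k).lt_of_ne' hk)

theorem muProd_inf_preBar (hΦ : F.IsCoherent Φ) (i : Ag) (f : Fin F.n → M.carrier) :
    muProd M F Φ i (f ⊓ preBar M F Φ) = muProd M F Φ i f := by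
  refine Finset.sum_congr rfl fun e _ => Finset.sum_congr rfl fun k _ => ?_
  by_cases hk : F.pre e k = 0
  · rw [hk, mul_zero, mul_zero]
  · have hinf {l : Fin F.m} (hl : Φ l ≤ Φ k) : f e ⊓ preBar M F Φ e ⊓ Φ l = f e ⊓ Φ l := by
      rw [inf_assoc, inf_eq_right.2 (hl.trans (le_preBar hk))]
    rw [Pi.inf_apply, muPart, muPart, hinf le_rfl, Finset.sum_congr rfl fun l hl =>
      congrArg (M.mu i) (hinf (hΦ.le l k (mem_mb.1 hl).1))]

theorem muProd_pos (h : IsMonadic M.dia M.box) (hμ : IsMeasure (M.dia i) (M.mu i))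
    (hΦ : F.IsCoherent Φ) {c : Fin F.n → M.carrier} (hc : IsMin (prodDia M F i) c)
    (hne : ¬ Disjoint c (preBar M F Φ)) : 0 < muProd M F Φ i c := by
  rw [← muProd_inf_preBar hΦ, ← (isPremeasure_muProd h hμ.toIsPremeasure hΦ).bot_eq_zero hc]
  exact muProd_lt_muProd h hμ hΦ hc (bot_lt_iff_ne_bot.2 (disjoint_iff.not.1 hne)) inf_le_left
    inf_le_right

theorem updMu_eq_div (hM : M.IsAPE) (hΦ : F.IsCoherent Φ) {q r : PQ (preBar M F Φ)}
    (hr : IsMin (updDia M F Φ i) r) (hqr : q ≤ r) :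
    updMu M F Φ i q = muProd M F Φ i (PQ.iota _ q) / muProd M F Φ i (PQ.iota _ r) := by
  have hprod := isMonadic_prod hM.epistemic.toIsMonadic F
  by_cases hq : q = ⊥
  · have hpre := PQ.isPremeasure_comp_iota (a := preBar M F Φ) hprod
      (isPremeasure_muProd hM.epistemic.toIsMonadic (hM.measure i).toIsPremeasure hΦ)
    rw [updMu, if_pos hq, hq, hpre.bot_eq_zero hr, zero_div]
  · have hex : ∃ f, IsMin (updDia M F Φ i) f ∧ q ≤ f := ⟨r, hr, hqr⟩
    have heq : hex.choose = r := (PQ.isMonadic hprod _).isMin_eq_of_not_disjoint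
      hex.choose_spec.1 hr fun hd => hq (disjoint_self.1 (hd.mono hex.choose_spec.2 hqr))
    rw [updMu, if_neg hq, dif_pos hex, heq]

theorem isMeasure_updMu (hM : M.IsAPE) (hΦ : F.IsCoherent Φ) (i : Ag) :
    IsMeasure (updDia M F Φ i) (updMu M F Φ i) := by
  have hmon := hM.epistemic.toIsMonadic
  have hprod := isMonadic_prod hmon F
  refine (PQ.isPremeasure_comp_iota hprod (isPremeasure_muProd hmon
    (hM.measure i).toIsPremeasure hΦ)).isMeasure_of_eq_div (fun q hq r s hrs hs => ?_)
    fun q hq r hrq => updMu_eq_div hM hΦ hq hrq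
  obtain ⟨c, hc, -, rfl⟩ := PQ.exists_isMin_eq_mk hprod hq
  exact muProd_lt_muProd hmon (hM.measure i) hΦ hc (PQ.iota_lt_iota.2 hrs)
    ((PQ.iota_le_iota.2 hs).trans inf_le_left) (PQ.iota_le _ s)

theorem IsAPE.update (hM : M.IsAPE) (hΦ : F.IsCoherent Φ) (s : Fin F.n → At → M.carrier) :
    (M.update F Φ s).IsAPE where
  epistemic := PQ.isEpistemic (isEpistemic_prod hM.epistemic F) _
  measure := isMeasure_updMu hM hΦ

end Model

end Update

section Probability

open Model

variable {Ag : Type u} {At : Type v} {M : Model.{u, v, w} Ag At} {i : Ag} {a : M.carrier}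
  {φ ψ : Formula Ag At}

theorem Model.interp_top : interp (.top : Formula Ag At) M = ⊤ := himp_self

theorem Model.interp_imp_eq_top_iff : interp (.imp φ ψ) M = ⊤ ↔ interp φ M ≤ interp ψ M :=
  himp_eq_top_iff

theorem Model.interp_iff_eq_top_iff : interp (.iff φ ψ) M = ⊤ ↔ interp φ M = interp ψ M :=
  inf_eq_top_iff.trans
    ((and_congr interp_imp_eq_top_iff interp_imp_eq_top_iff).trans le_antisymm_iff.symm)

namespace LTerm

/-- The value `∑ₖ αₖ μᵢ(⟦φₖ⟧ ⊓ a)` of a linear term of agent `i` at an element `a` of a model. -/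
noncomputable def value (M : Model.{u, v, w} Ag At) (i : Ag) (t : LTerm Ag At)
    (a : M.carrier) : ℝ :=
  ∑ k, t.coeff k * M.mu i (interp (t.arg k) M ⊓ a)

section Value

variable (i a)

theorem value_zero : (zero : LTerm Ag At).value M i a = 0 := Finset.sum_empty

theorem value_single (α : ℝ) (φ : Formula Ag At) :
    (single α φ).value M i a = α * M.mu i (interp φ M ⊓ a) :=
  Fin.sum_univ_one _

theorem value_mu (φ : Formula Ag At) : (mu φ).value M i a = M.mu i (interp φ M ⊓ a) := by
  rw [mu, value_single, one_mul]

theorem value_add (t t' : LTerm Ag At) :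
    (t.add t').value M i a = t.value M i a + t'.value M i a := by
  refine (Fin.sum_univ_add fun k => Fin.append t.coeff t'.coeff k *
    M.mu i (interp (Fin.append t.arg t'.arg k) M ⊓ a)).trans ?_
  simp only [Fin.append_left, Fin.append_right, value]

theorem value_smul (d : ℝ) (t : LTerm Ag At) : (t.smul d).value M i a = d * t.value M i a := by
  rw [value, value, Finset.mul_sum]
  exact Finset.sum_congr rfl fun k _ => mul_assoc _ _ _

theorem value_neg (t : LTerm Ag At) : t.neg.value M i a = -t.value M i a := by
  rw [neg, value_smul, neg_one_mul]

theorem value_bigSum (l : List (LTerm Ag At)) :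
    (bigSum l).value M i a = (l.map fun t => t.value M i a).sum := by
  induction l with
  | nil => exact value_zero i a
  | cons t l ih => rw [bigSum, value_add, ih, List.map_cons, List.sum_cons]

end Value

variable {t t' : LTerm Ag At} {β : ℝ}

theorem interp_ge (i : Ag) (t : LTerm Ag At) (β : ℝ) :
    interp (ge i t β) M = minSup (M.dia i) fun a => β ≤ t.value M i a := rfl

theorem dia_interp_ge (h : IsMonadic M.dia M.box) (i : Ag) (t : LTerm Ag At) (β : ℝ) :
    M.dia i (interp (ge i t β) M) = interp (ge i t β) M :=
  h.dia_minSup i _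

theorem dia_interp_eqT (h : IsMonadic M.dia M.box) (i : Ag) (t t' : LTerm Ag At) :
    M.dia i (interp (eqT i t t') M) = interp (eqT i t t') M :=
  h.dia_inf_eq_self (dia_interp_ge h i _ 0) (dia_interp_ge h i _ 0)

theorem le_interp_ge_iff (h : IsMonadic M.dia M.box) (ha : IsMin (M.dia i) a) :
    a ≤ interp (ge i t β) M ↔ β ≤ t.value M i a :=
  h.isMin_le_minSup_iff ha

theorem le_interp_le_iff (h : IsMonadic M.dia M.box) (ha : IsMin (M.dia i) a) :
    a ≤ interp (le i t β) M ↔ t.value M i a ≤ β := by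
  rw [le, le_interp_ge_iff h ha, value_neg, neg_le_neg_iff]

theorem le_interp_geT_iff (h : IsMonadic M.dia M.box) (ha : IsMin (M.dia i) a) :
    a ≤ interp (geT i t t') M ↔ t'.value M i a ≤ t.value M i a := by
  rw [geT, le_interp_ge_iff h ha, value_add, value_neg, ← sub_eq_add_neg, sub_nonneg]

theorem le_interp_eq_iff (h : IsMonadic M.dia M.box) (ha : IsMin (M.dia i) a) :
    a ≤ interp (eq i t β) M ↔ t.value M i a = β :=
  le_inf_iff.trans ((and_congr (le_interp_ge_iff h ha) (le_interp_le_iff h ha)).trans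
    (and_comm.trans le_antisymm_iff.symm))

theorem le_interp_eqT_iff (h : IsMonadic M.dia M.box) (ha : IsMin (M.dia i) a) :
    a ≤ interp (eqT i t t') M ↔ t.value M i a = t'.value M i a :=
  le_inf_iff.trans ((and_congr (le_interp_geT_iff h ha) (le_interp_geT_iff h ha)).trans
    (and_comm.trans le_antisymm_iff.symm))

end LTerm

namespace Model

open LTerm

variable {t t' : LTerm Ag At} {β : ℝ}

theorem interp_geT_eq_top (hM : M.IsAPE)
    (h : ∀ a, IsMin (M.dia i) a → t'.value M i a ≤ t.value M i a) :
    interp (geT i t t') M = ⊤ :=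
  hM.epistemic.eq_top_of_forall_isMin_le fun a ha =>
    (le_interp_geT_iff hM.epistemic.toIsMonadic ha).2 (h a ha)

theorem interp_eq_eq_top (hM : M.IsAPE) (h : ∀ a, IsMin (M.dia i) a → t.value M i a = β) :
    interp (eq i t β) M = ⊤ :=
  hM.epistemic.eq_top_of_forall_isMin_le fun a ha =>
    (le_interp_eq_iff hM.epistemic.toIsMonadic ha).2 (h a ha)

theorem interp_eqT_eq_top (hM : M.IsAPE)
    (h : ∀ a, IsMin (M.dia i) a → t.value M i a = t'.value M i a) :
    interp (eqT i t t') M = ⊤ :=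
  hM.epistemic.eq_top_of_forall_isMin_le fun a ha =>
    (le_interp_eqT_iff hM.epistemic.toIsMonadic ha).2 (h a ha)

theorem interp_ge_inf_ge_le (hM : M.IsAPE) {β' β'' : ℝ} {t'' : LTerm Ag At}
    (h : ∀ a, IsMin (M.dia i) a → β ≤ t.value M i a → β' ≤ t'.value M i a →
      β'' ≤ t''.value M i a) :
    interp (ge i t β) M ⊓ interp (ge i t' β') M ≤ interp (ge i t'' β'') M := by
  have hmon := hM.epistemic.toIsMonadic
  refine hM.epistemic.le_of_forall_isMin_le (i := i)
    (hmon.dia_inf_eq_self (dia_interp_ge hmon i t β) (dia_interp_ge hmon i t' β'))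
    fun a ha hle => (le_interp_ge_iff hmon ha).2 ?_
  rw [le_inf_iff, le_interp_ge_iff hmon ha, le_interp_ge_iff hmon ha] at hle
  exact h a ha hle.1 hle.2

theorem interp_ge_perm_le (n : ℕ) (α : Fin n → ℝ) (φ : Fin n → Formula Ag At) (β : ℝ)
    (σ : Equiv.Perm (Fin n)) :
    interp (.prob i n α φ β) M ≤ interp (.prob i n (α ∘ σ) (φ ∘ σ) β) M :=
  minSup_le fun _ ha hQ => le_minSup ha (hQ.trans_eq (Equiv.sum_comp σ _).symm)

theorem interp_ge_sum_le (hM : M.IsAPE) (n : ℕ) (α α' : Fin n → ℝ) (φ : Fin n → Formula Ag At)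
    (β β' : ℝ) :
    interp (.prob i n α φ β) M ⊓ interp (.prob i n α' φ β') M ≤
      interp (.prob i n (fun k => α k + α' k) φ (β + β')) M :=
  interp_ge_inf_ge_le hM (t := ⟨n, α, φ⟩) (t' := ⟨n, α', φ⟩) (t'' := ⟨n, _, φ⟩) fun a _ h h' => by
    simpa only [value, add_mul, Finset.sum_add_distrib] using add_le_add h h'

theorem interp_ge_smul_le (hM : M.IsAPE) (t : LTerm Ag At) (β d : ℝ) :
    interp (ge i t β) M ⊓ interp (constNonneg i d) M ≤ interp (ge i (t.smul d) (d * β)) M :=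
  interp_ge_inf_ge_le hM fun a _ h h' => by
    rw [value_zero, neg_nonpos] at h'
    rw [value_smul]
    exact mul_le_mul_of_nonneg_left h h'

theorem interp_ge_sup_le_eq_top (hM : M.IsAPE) (t : LTerm Ag At) (β : ℝ) :
    interp (ge i t β) M ⊔ interp (le i t β) M = ⊤ :=
  have hmon := hM.epistemic.toIsMonadic
  hM.epistemic.eq_top_of_forall_isMin_le fun a ha => (le_total β (t.value M i a)).elim
    (fun h => le_sup_of_le_left ((le_interp_ge_iff hmon ha).2 h))
    fun h => le_sup_of_le_right ((le_interp_le_iff hmon ha).2 h)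

theorem interp_ge_le_gt (hM : M.IsAPE) (t : LTerm Ag At) {β γ : ℝ} (h : γ < β) :
    interp (ge i t β) M ≤ interp (gt i t γ) M := by
  have hmon := hM.epistemic.toIsMonadic
  refine le_himp_iff.2 (hM.epistemic.le_of_forall_isMin_le (i := i)
    (hmon.dia_inf_eq_self (dia_interp_ge hmon i t β) (dia_interp_ge hmon i t.neg (-γ)))
    fun a ha hle => ?_)
  have hβ := (le_interp_ge_iff hmon ha).1 (le_inf_iff.1 hle).1
  have hγ := (le_interp_le_iff hmon ha).1 (le_inf_iff.1 hle).2
  exact absurd (hβ.trans hγ) h.not_ge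

theorem interp_mu_bot_eq_top (hM : M.IsAPE) : interp (eq i (.mu .bot) 0) M = ⊤ :=
  interp_eq_eq_top hM fun a ha => by
    rw [value_mu, interp, bot_inf_eq, (hM.measure i).bot_eq_zero ha]

theorem interp_mu_top_eq_top (hM : M.IsAPE) : interp (eq i (.mu .top) 1) M = ⊤ :=
  interp_eq_eq_top hM fun a ha => by
    rw [value_mu, interp_top, top_inf_eq, (hM.measure i).one a ha]

theorem interp_mu_or_eq_top (hM : M.IsAPE) (φ ψ : Formula Ag At) :
    interp (eqT i ((LTerm.mu φ).add (.mu ψ)) ((LTerm.mu (.or φ ψ)).add (.mu (.and φ ψ)))) M = ⊤ :=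
  interp_eqT_eq_top hM fun a ha => by
    simp only [value_add, value_mu, interp]
    rw [inf_sup_right, (hM.measure i).join a ha _ _ inf_le_right inf_le_right,
      ← inf_inf_distrib_right, sub_add_cancel]

theorem interp_box_imp_inf_eqT (hM : M.IsAPE) (φ ψ : Formula Ag At) :
    interp (.box i (.imp φ ψ)) M ⊓ interp (eqT i (.mu φ) (.mu ψ)) M =
      interp (.box i (.iff ψ φ)) M := by
  have hmon := hM.epistemic.toIsMonadic
  refine hM.epistemic.eq_of_forall_isMin_le_iff
    (hmon.dia_inf_eq_self (hmon.dia_box i _) (dia_interp_eqT hmon i _ _)) (hmon.dia_box i _)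
    fun a ha => ?_
  have himp_iff (χ χ' : Formula Ag At) :
      a ≤ interp (.imp χ χ') M ↔ interp χ M ⊓ a ≤ interp χ' M ⊓ a := by
    rw [interp, le_himp_iff', le_inf_iff, and_iff_left inf_le_right]
  have hiff : a ≤ interp (.iff ψ φ) M ↔ interp φ M ⊓ a = interp ψ M ⊓ a :=
    le_inf_iff.trans ((and_congr (himp_iff ψ φ) (himp_iff φ ψ)).trans
      (and_comm.trans le_antisymm_iff.symm))
  change a ≤ M.box i (interp (.imp φ ψ) M) ⊓ _ ↔ a ≤ M.box i (interp (.iff ψ φ) M)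
  rw [le_inf_iff, hmon.le_box_iff ha.2.1, hmon.le_box_iff ha.2.1, le_interp_eqT_iff hmon ha,
    value_mu, value_mu, hiff, himp_iff]
  exact ⟨fun h => ((hM.measure i).eq_iff ha h.1 inf_le_right).1 h.2,
    fun h => ⟨h.le, congrArg (M.mu i) h⟩⟩

theorem interp_ge_le_box (h : IsMonadic M.dia M.box) (t : LTerm Ag At) (β : ℝ) :
    interp (ge i t β) M ≤ interp (.box i (ge i t β)) M :=
  (h.box_eq_self (dia_interp_ge h i t β)).ge

end Model

end Probability

section Reduction

open Model EventFrame LTerm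

variable {Ag : Type u} {At : Type v} {M : Model.{u, v, w} Ag At} {i : Ag}

namespace Model

theorem interp_bigOr_le_iff {l : List (Formula Ag At)} {c : M.carrier} :
    interp (.bigOr l) M ≤ c ↔ ∀ φ ∈ l, interp φ M ≤ c := by
  induction l with
  | nil => exact iff_of_true bot_le (List.forall_mem_nil _)
  | cons φ l ih => rw [Formula.bigOr, interp, sup_le_iff, ih, List.forall_mem_cons]

theorem le_interp_bigAnd_iff {l : List (Formula Ag At)} {c : M.carrier} :
    c ≤ interp (.bigAnd l) M ↔ ∀ φ ∈ l, c ≤ interp φ M := by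
  induction l with
  | nil => exact iff_of_true (le_top.trans_eq interp_top.symm) (List.forall_mem_nil _)
  | cons φ l ih => rw [Formula.bigAnd, interp, le_inf_iff, ih, List.forall_mem_cons]

end Model

namespace EventStr

variable {E : EventStr Ag At} {e e' : Fin E.frame.n} {φ ψ χ : Formula Ag At} {b : M.carrier}

/-- The interpretations of the formulas in `Φ`. -/
noncomputable abbrev interpΦ (E : EventStr Ag At) (M : Model.{u, v, w} Ag At) :
    Fin E.frame.m → M.carrier :=
  fun k => interp (E.Φ k) M

/-- The element `pre` of the product algebra, by which the update quotients it. -/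
noncomputable abbrev interpPre (E : EventStr Ag At) (M : Model.{u, v, w} Ag At) :
    Fin E.frame.n → M.carrier :=
  preBar M E.frame (E.interpΦ M)

/-- The updated model `M^𝓔`. -/
noncomputable abbrev update (E : EventStr Ag At) (M : Model.{u, v, w} Ag At) :
    Model.{u, v, w} Ag At :=
  M.update E.frame (E.interpΦ M) fun e p => interp (E.sub e p) M

/-- The representative below `pre` of the interpretation of `φ` in the updated model. -/
noncomputable def interpAfter (E : EventStr Ag At) (M : Model.{u, v, w} Ag At)
    (φ : Formula Ag At) : Fin E.frame.n → M.carrier :=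
  PQ.iota (E.interpPre M) (interp φ (E.update M))

theorem interpAfter_le (φ : Formula Ag At) : E.interpAfter M φ ≤ E.interpPre M :=
  PQ.iota_le (E.interpPre M) _

theorem interp_dBox : interp (.dBox E e φ) M = E.interpPre M e ⇨ E.interpAfter M φ e := rfl

theorem interp_dDia : interp (.dDia E e φ) M = E.interpAfter M φ e :=
  inf_eq_right.2 (interpAfter_le φ e)

theorem interp_preF : interp (E.preF e) M = E.interpPre M e :=
  eq_of_forall_ge_iff fun c => by
    simp only [preF, interp_bigOr_le_iff, List.forall_mem_map, List.mem_filter,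
      List.mem_finRange, true_and, decide_eq_true_eq, preBar_le_iff]

theorem mem_cell : e' ∈ E.cell i e ↔ E.frame.rel i e' e := by
  simp only [cell, List.mem_filter, List.mem_finRange, true_and, decide_eq_true_eq]

theorem interpAfter_bot : E.interpAfter M .bot = ⊥ := PQ.iota_bot (a := E.interpPre M)

theorem interpAfter_top : E.interpAfter M .top = E.interpPre M := by
  rw [interpAfter, interp_top]
  exact PQ.iota_top (a := E.interpPre M)

theorem interpAfter_and :
    E.interpAfter M (.and φ ψ) = E.interpAfter M φ ⊓ E.interpAfter M ψ :=
  PQ.iota_inf (a := E.interpPre M) _ _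

theorem interpAfter_or :
    E.interpAfter M (.or φ ψ) = E.interpAfter M φ ⊔ E.interpAfter M ψ :=
  PQ.iota_sup (a := E.interpPre M) _ _

theorem interpAfter_atom (p : At) :
    E.interpAfter M (.atom p) e = interp (E.sub e p) M ⊓ E.interpPre M e := rfl

theorem interpAfter_imp : E.interpAfter M (.imp φ ψ) e =
    interp (.imp (.dDia E e φ) (.dDia E e ψ)) M ⊓ E.interpPre M e := by
  rw [interp, interp_dDia, interp_dDia]
  rfl

theorem interpAfter_dia : E.interpAfter M (.dia i φ) e =
    interp (.bigOr ((E.cell i e).map fun e' => .dia i (.dDia E e' φ))) M ⊓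
      E.interpPre M e := by
  refine (congrFun (PQ.iota_dia (a := E.interpPre M) _ _) e).trans
    (congrArg (· ⊓ E.interpPre M e) (eq_of_forall_ge_iff fun c => ?_))
  simp only [prodDia_le_iff, interp_bigOr_le_iff, List.forall_mem_map, mem_cell, interp,
    interp_dDia, interpAfter]

theorem interpAfter_box : E.interpAfter M (.box i φ) e =
    interp (.bigAnd ((E.cell i e).map fun e' => .box i (.dBox E e' φ))) M ⊓
      E.interpPre M e := by
  refine (congrFun (PQ.iota_box (a := E.interpPre M) _ _) e).trans
    (congrArg (· ⊓ E.interpPre M e) (eq_of_forall_le_iff fun c => ?_))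
  simp only [le_prodBox_iff, le_interp_bigAnd_iff, List.forall_mem_map, mem_cell, interp,
    interp_dBox, interpAfter, Pi.himp_apply]

theorem interp_dBox_iff_eq_top (h : E.interpAfter M φ e = interp χ M ⊓ E.interpPre M e) :
    interp (.iff (.dBox E e φ) (.imp (E.preF e) χ)) M = ⊤ := by
  rw [interp_iff_eq_top_iff, interp_dBox, h, interp, interp_preF, himp_inf_distrib, himp_self,
    inf_top_eq]

theorem interp_dDia_iff_eq_top (h : E.interpAfter M φ e = interp χ M ⊓ E.interpPre M e) :
    interp (.iff (.dDia E e φ) (.and (E.preF e) χ)) M = ⊤ := by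
  rw [interp_iff_eq_top_iff, interp_dDia, h, interp, interp_preF, inf_comm]

theorem value_muT (k : Fin E.frame.m) (χ : Formula Ag At) (b : M.carrier) :
    (E.muT k χ).value M i b = muPart M E.frame (E.interpΦ M) i k (interp χ M ⊓ b) := by
  classical
  have value_and (l : Fin E.frame.m) : (LTerm.mu (.and χ (E.Φ l))).value M i b =
      M.mu i (interp χ M ⊓ b ⊓ E.interpΦ M l) := by
    rw [value_mu, interp, inf_right_comm]
  rw [muT, value_add, value_neg, value_bigSum, value_and, List.map_map, ← sub_eq_add_neg,
    muPart, ← List.sum_toFinset _ ((List.nodup_finRange _).filter _)]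
  refine congrArg _ (Finset.sum_congr ?_ fun l _ => value_and l)
  ext l
  simp only [List.mem_toFinset, List.mem_filter, List.mem_finRange, true_and,
    decide_eq_true_eq]

theorem value_sumT (hμ : IsPremeasure (M.dia i) (M.mu i)) (hb : IsMin (M.dia i) b) (c : ℝ)
    (χ : Fin E.frame.n → Formula Ag At) :
    (E.sumT i e c χ).value M i b = c * muProd M E.frame (E.interpΦ M) i
      ((fun e' => interp (χ e') M) ⊓ E.frame.cellFun i e b) := by
  classical
  have muPart_bot (k : Fin E.frame.m) : muPart M E.frame (E.interpΦ M) i k ⊥ = 0 := by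
    simp only [muPart, bot_inf_eq, hμ.bot_eq_zero hb, Finset.sum_const_zero, sub_zero]
  have hcell : (E.cell i e).toFinset = Finset.univ.filter fun e' => E.frame.rel i e' e := by
    ext e'
    rw [List.mem_toFinset, mem_cell, Finset.mem_filter_univ]
  have hnodup : (E.cell i e).Nodup := (List.nodup_finRange _).filter _
  rw [sumT, value_bigSum, List.map_map, ← List.sum_toFinset _ hnodup, hcell,
    Finset.sum_filter, muProd, Finset.mul_sum]
  refine Finset.sum_congr rfl fun e' _ => ?_
  rw [Function.comp_apply, value_bigSum, List.map_map,
    ← List.sum_toFinset _ (List.nodup_finRange _), List.toFinset_finRange, Finset.mul_sum]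
  split_ifs with he
  · refine Finset.sum_congr rfl fun k _ => ?_
    rw [Function.comp_apply, value_smul, value_muT, Pi.inf_apply, cellFun_of_rel he]
    ring
  · simp only [Pi.inf_apply, cellFun_of_not_rel he, inf_bot_eq, muPart_bot, mul_zero, zero_mul,
      Finset.sum_const_zero]

theorem le_interp_redF_iff (hM : M.IsAPE) (hΦ : E.frame.IsCoherent (E.interpΦ M))
    (hb : IsMin (M.dia i) b) (α β : ℝ) (ψ : Formula Ag At) :
    b ≤ interp (E.redF i e α β ψ) M ↔
      β * muProd M E.frame (E.interpΦ M) i (E.frame.cellFun i e b) ≤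
        α * muProd M E.frame (E.interpΦ M) i (E.interpAfter M ψ ⊓ E.frame.cellFun i e b) := by
  have hμ := (hM.measure i).toIsPremeasure
  have hbox : (fun e' => interp (.dBox E e' ψ) M) ⊓ E.interpPre M = E.interpAfter M ψ :=
    (himp_inf_self _ _).trans (inf_eq_left.2 (interpAfter_le ψ))
  rw [redF, le_interp_ge_iff hM.epistemic.toIsMonadic hb, value_add, value_sumT hμ hb,
    value_sumT hμ hb, ← muProd_inf_preBar hΦ i (_ ⊓ _), inf_right_comm, hbox]
  simp only [interp_top]
  rw [show (fun _ : Fin E.frame.n => (⊤ : M.carrier)) = ⊤ from rfl, top_inf_eq, neg_mul,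
    ← sub_eq_add_neg, sub_nonneg]

theorem le_value_update_iff (hM : M.IsAPE) (hΦ : E.frame.IsCoherent (E.interpΦ M))
    (hb : IsMin (M.dia i) b) (he : ¬ Disjoint b (E.interpPre M e)) (α β : ℝ)
    (ψ : Formula Ag At) :
    β ≤ (single α ψ).value (E.update M) i (PQ.mk (E.interpPre M) (E.frame.cellFun i e b)) ↔
      b ≤ interp (E.redF i e α β ψ) M := by
  have hmon := hM.epistemic.toIsMonadic
  have hcell := isMin_cellFun hmon hb e
  have hpre := not_disjoint_cellFun (i := i) he
  have hinf : PQ.iota (E.interpPre M) ((interp ψ (E.update M) : PQ (E.interpPre M)) ⊓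
        PQ.mk (E.interpPre M) (E.frame.cellFun i e b)) =
      E.interpAfter M ψ ⊓ E.frame.cellFun i e b ⊓ E.interpPre M :=
    (PQ.iota_inf _ _).trans (inf_assoc _ _ _).symm
  have hvalue : (single α ψ).value (E.update M) i
        (PQ.mk (E.interpPre M) (E.frame.cellFun i e b)) =
      α * (muProd M E.frame (E.interpΦ M) i (E.interpAfter M ψ ⊓ E.frame.cellFun i e b) /
        muProd M E.frame (E.interpΦ M) i (E.frame.cellFun i e b)) :=
    (value_single i _ α ψ).trans (congrArg (α * ·) ((updMu_eq_div hM hΦ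
      (PQ.isMin_mk (isMonadic_prod hmon E.frame) hcell hpre) inf_le_right).trans
      (congrArg₂ (· / ·) ((congrArg _ hinf).trans (muProd_inf_preBar hΦ i _))
        (muProd_inf_preBar hΦ i _))))
  rw [hvalue, ← mul_div_assoc, le_div_iff₀ (muProd_pos hmon (hM.measure i) hΦ hcell hpre),
    le_interp_redF_iff hM hΦ hb]

theorem interpAfter_ge (hM : M.IsAPE) (hΦ : E.frame.IsCoherent (E.interpΦ M)) (α β : ℝ)
    (ψ : Formula Ag At) : E.interpAfter M (ge i (single α ψ) β) e =
      interp (E.redF i e α β ψ) M ⊓ E.interpPre M e := by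
  have hmon := hM.epistemic.toIsMonadic
  refine (congrFun (PQ.iota_minSup (isMonadic_prod hmon E.frame) i fun q =>
    β ≤ (single α ψ).value (E.update M) i q) e).trans ?_
  rw [Pi.inf_apply, minSup_prodDia_apply hmon]
  exact minSup_inf_congr fun b hb he => (le_value_update_iff hM hΦ hb he α β ψ).trans
    (le_interp_ge_iff hmon hb)

end EventStr

end Reduction

section Soundness

open Model EventStr

variable {Ag : Type u} {At : Type v} {E : EventStr Ag At} {A B φ φ' : Formula Ag At}

/-- Truth in all APE-models. -/
def Valid (φ : Formula Ag At) : Prop :=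
  ∀ M : Model.{u, v, w} Ag At, M.IsAPE → interp φ M = ⊤

/-- The semantic counterpart of the two derivability conditions on the set `Φ` of an event
structure: they hold in all APE-models. -/
def EventStr.IsCoherent (E : EventStr Ag At) : Prop :=
  ∀ M : Model.{u, v, w} Ag At, M.IsAPE → E.frame.IsCoherent (E.interpΦ M)

/-- The semantic counterpart of `WF`: all event structures that occur in the formula, at any
depth, are coherent. -/
def Formula.HereditarilyCoherent : Formula Ag At → Prop
  | .atom _ => True
  | .bot => True
  | .and φ ψ => φ.HereditarilyCoherent ∧ ψ.HereditarilyCoherent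
  | .or φ ψ => φ.HereditarilyCoherent ∧ ψ.HereditarilyCoherent
  | .imp φ ψ => φ.HereditarilyCoherent ∧ ψ.HereditarilyCoherent
  | .dia _ φ => φ.HereditarilyCoherent
  | .box _ φ => φ.HereditarilyCoherent
  | .evDia F Φ sub _ φ | .evBox F Φ sub _ φ =>
      ((∀ k, (Φ k).HereditarilyCoherent) ∧ (∀ e p, (sub e p).HereditarilyCoherent) ∧
        EventStr.IsCoherent.{u, v, w} ⟨F, Φ, sub⟩) ∧ φ.HereditarilyCoherent
  | .prob _ _ _ φ _ => ∀ k, (φ k).HereditarilyCoherent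

/-- The semantic counterpart of `WFEvent`: the event structure and all those that occur in its
formulas are coherent. -/
def EventStr.HereditarilyCoherent (E : EventStr Ag At) : Prop :=
  (∀ k, Formula.HereditarilyCoherent.{u, v, w} (E.Φ k)) ∧
    (∀ e p, Formula.HereditarilyCoherent.{u, v, w} (E.sub e p)) ∧
      EventStr.IsCoherent.{u, v, w} E

section Replacement

variable {M : Model.{u, v, w} Ag At} {F : EventFrame Ag} {Φ Φ' : Fin F.m → Formula Ag At}
  {sub sub' : Fin F.n → At → Formula Ag At}

theorem interp_evDia_congr (hΦ : ∀ k, interp (Φ k) M = interp (Φ' k) M)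
    (hsub : ∀ e p, interp (sub e p) M = interp (sub' e p) M)
    (hφ : interp φ (EventStr.update ⟨F, Φ, sub⟩ M) = interp φ' (EventStr.update ⟨F, Φ, sub⟩ M))
    (e : Fin F.n) : interp (.evDia F Φ sub e φ) M = interp (.evDia F Φ' sub' e φ') M := by
  have hsubs := funext₂ hsub
  rw [interp, interp, ← funext hΦ, ← hsubs, hφ]

theorem interp_evBox_congr (hΦ : ∀ k, interp (Φ k) M = interp (Φ' k) M)
    (hsub : ∀ e p, interp (sub e p) M = interp (sub' e p) M)
    (hφ : interp φ (EventStr.update ⟨F, Φ, sub⟩ M) = interp φ' (EventStr.update ⟨F, Φ, sub⟩ M))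
    (e : Fin F.n) : interp (.evBox F Φ sub e φ) M = interp (.evBox F Φ' sub' e φ') M := by
  have hsubs := funext₂ hsub
  rw [interp, interp, ← funext hΦ, ← hsubs, hφ]

theorem interp_eq_of_repl (hAB : Valid.{u, v, w} (.iff A B)) (h : Repl A B φ φ')
    (hφ : Formula.HereditarilyCoherent.{u, v, w} φ) (hM : M.IsAPE) :
    interp φ M = interp φ' M := by
  induction h generalizing M with
  | here => exact interp_iff_eq_top_iff.1 (hAB M hM)
  | refl => rfl
  | and _ _ ih ih' => exact congrArg₂ (· ⊓ ·) (ih hφ.1 hM) (ih' hφ.2 hM)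
  | or _ _ ih ih' => exact congrArg₂ (· ⊔ ·) (ih hφ.1 hM) (ih' hφ.2 hM)
  | imp _ _ ih ih' => exact congrArg₂ (· ⇨ ·) (ih hφ.1 hM) (ih' hφ.2 hM)
  | dia _ ih => exact congrArg (M.dia _) (ih hφ hM)
  | box _ ih => exact congrArg (M.box _) (ih hφ hM)
  | evDia _ _ _ ihΦ ihsub ih =>
    obtain ⟨⟨hΦ, hsub, hcoh⟩, hφ⟩ := hφ
    exact interp_evDia_congr (fun k => ihΦ k (hΦ k) hM) (fun e p => ihsub e p (hsub e p) hM)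
      (ih hφ (hM.update (hcoh M hM) _)) _
  | evBox _ _ _ ihΦ ihsub ih =>
    obtain ⟨⟨hΦ, hsub, hcoh⟩, hφ⟩ := hφ
    exact interp_evBox_congr (fun k => ihΦ k (hΦ k) hM) (fun e p => ihsub e p (hsub e p) hM)
      (ih hφ (hM.update (hcoh M hM) _)) _
  | prob _ ih => simp only [interp, fun k => ih k (hφ k) hM]

end Replacement

theorem himp_himp_le_himp_himp {α : Type*} [GeneralizedHeytingAlgebra α] (a b c : α) :
    a ⇨ b ⇨ c ≤ (a ⇨ b) ⇨ a ⇨ c := by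
  rw [le_himp_iff, ← himp_inf_distrib]
  exact himp_le_himp_left himp_inf_le

theorem Ax.valid (h : Ax φ) (hφ : Formula.HereditarilyCoherent.{u, v, w} φ) :
    Valid.{u, v, w} φ := by
  intro M hM
  have hE := hM.epistemic
  cases h with
  | h1 A B => exact interp_imp_eq_top_iff.2 le_himp
  | h2 A B C => exact interp_imp_eq_top_iff.2 (himp_himp_le_himp_himp _ _ _)
  | h3 A B => exact interp_imp_eq_top_iff.2 (le_himp_iff.2 le_rfl)
  | h4 A B C => exact interp_imp_eq_top_iff.2 (le_himp_iff.2 (sup_himp_distrib _ _ _).ge)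
  | h5 A B => exact interp_imp_eq_top_iff.2 inf_le_left
  | h6 A B => exact interp_imp_eq_top_iff.2 inf_le_right
  | h7 A B => exact interp_imp_eq_top_iff.2 le_sup_left
  | h8 A B => exact interp_imp_eq_top_iff.2 le_sup_right
  | h9 A => exact interp_imp_eq_top_iff.2 bot_le
  | m1 i A => exact interp_imp_eq_top_iff.2 (hE.m1 i _)
  | m2 i A => exact interp_imp_eq_top_iff.2 (hE.m2 i _)
  | m3 i A B => exact interp_imp_eq_top_iff.2 (hE.m3 i _ _)
  | m4 i A B => exact interp_imp_eq_top_iff.2 (hE.m4 i _ _)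
  | m5 i A => exact interp_imp_eq_top_iff.2 (hE.m5 i _)
  | m6 i A => exact interp_imp_eq_top_iff.2 (hE.m6 i _)
  | m7 i A B => exact interp_imp_eq_top_iff.2 (hE.m7 i _ _)
  | e i A =>
    rw [interp, Formula.neg, interp, interp, interp, himp_bot]
    exact hE.e i _
  | n0 i t => exact interp_geT_eq_top hM fun _ _ => le_rfl
  | n1 i t β φ =>
    simp only [interp_iff_eq_top_iff, LTerm.interp_ge, LTerm.value_add, LTerm.value_single,
      zero_mul, add_zero]
  | n2 i n α φ β σ => exact interp_imp_eq_top_iff.2 (interp_ge_perm_le n α φ β σ)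
  | n3 i n α α' φ β β' => exact interp_imp_eq_top_iff.2 (interp_ge_sum_le hM n α α' φ β β')
  | n4 i t β d => exact interp_imp_eq_top_iff.2 (interp_ge_smul_le hM t β d)
  | n5 i t β => exact interp_ge_sup_le_eq_top hM t β
  | n6 i t β γ h => exact interp_imp_eq_top_iff.2 (interp_ge_le_gt hM t h)
  | p1 i => exact interp_mu_bot_eq_top hM
  | p2 i => exact interp_mu_top_eq_top hM
  | p3 i φ ψ => exact interp_mu_or_eq_top hM φ ψ
  | p4 i φ ψ => exact interp_iff_eq_top_iff.2 (interp_box_imp_inf_eqT hM φ ψ)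
  | p5 i n α φ β => exact interp_imp_eq_top_iff.2 (interp_ge_le_box hE.toIsMonadic ⟨n, α, φ⟩ β)
  | i1 E e p => exact interp_dBox_iff_eq_top (interpAfter_atom p)
  | i2 E e p => exact interp_dDia_iff_eq_top (interpAfter_atom p)
  | i3 E e => rw [interp_iff_eq_top_iff, interp_dBox, interpAfter_top, himp_self, interp_top]
  | i4 E e => rw [interp_iff_eq_top_iff, interp_dDia, interpAfter_top, interp_preF]
  | i5 E e =>
    rw [interp_iff_eq_top_iff, interp_dBox, interpAfter_bot, Formula.neg, interp, interp_preF,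
      interp, Pi.bot_apply]
  | i6 E e => rw [interp_iff_eq_top_iff, interp_dDia, interpAfter_bot, interp, Pi.bot_apply]
  | i7 E e φ ψ =>
    simp only [interp_iff_eq_top_iff, interp, interp_dBox, interpAfter_and, Pi.inf_apply,
      himp_inf_distrib]
  | i8 E e φ ψ =>
    simp only [interp_iff_eq_top_iff, interp, interp_dDia, interpAfter_and, Pi.inf_apply]
  | i9 E e φ ψ =>
    simp only [interp_iff_eq_top_iff, interp, interp_dBox, interp_dDia, interp_preF,
      interpAfter_or, Pi.sup_apply]
  | i10 E e φ ψ =>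
    simp only [interp_iff_eq_top_iff, interp, interp_dDia, interpAfter_or, Pi.sup_apply]
  | i11 E e φ ψ =>
    rw [interp_iff_eq_top_iff, interp_dBox, interpAfter_imp, himp_inf_distrib, himp_self,
      inf_top_eq, interp, interp_dDia, interp_dDia, himp_himp, inf_eq_right.2 (interpAfter_le φ e)]
  | i12 E e φ ψ => exact interp_dDia_iff_eq_top interpAfter_imp
  | i13 E e i ψ => exact interp_dBox_iff_eq_top interpAfter_dia
  | i14 E e i ψ => exact interp_dDia_iff_eq_top interpAfter_dia
  | i15 E e i ψ => exact interp_dBox_iff_eq_top interpAfter_box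
  | i16 E e i ψ => exact interp_dDia_iff_eq_top interpAfter_box
  | i17 E e i ψ α β =>
    obtain ⟨⟨⟨⟨_, _, hΦ⟩, _⟩, _⟩, _⟩ := hφ
    exact interp_dBox_iff_eq_top (interpAfter_ge hM (hΦ M hM) α β ψ)
  | i18 E e i ψ α β =>
    obtain ⟨⟨⟨⟨_, _, hΦ⟩, _⟩, _⟩, _⟩ := hφ
    exact interp_dDia_iff_eq_top (interpAfter_ge hM (hΦ M hM) α β ψ)

namespace Valid

theorem mp (hAB : Valid.{u, v, w} (.imp A B)) (hA : Valid.{u, v, w} A) : Valid.{u, v, w} B :=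
  fun M hM => top_le_iff.1 ((hA M hM).ge.trans (interp_imp_eq_top_iff.1 (hAB M hM)))

theorem box (hA : Valid.{u, v, w} A) (i : Ag) : Valid.{u, v, w} (.box i A) := fun M hM => by
  rw [interp, hA M hM, hM.epistemic.box_top]

theorem dBox (hA : Valid.{u, v, w} A) (hE : EventStr.IsCoherent.{u, v, w} E)
    (e : Fin E.frame.n) : Valid.{u, v, w} (.dBox E e A) := fun M hM => by
  have hupd : (E.update M).IsAPE := hM.update (hE M hM) _
  rw [interp_dBox, interpAfter, (hA _ hupd).trans interp_top.symm, ← interpAfter,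
    interpAfter_top, himp_self]

theorem geT_mu (hAB : Valid.{u, v, w} (.imp A B)) (i : Ag) :
    Valid.{u, v, w} (LTerm.geT i (.mu B) (.mu A)) := fun M hM =>
  interp_geT_eq_top hM fun a ha => by
    rw [LTerm.value_mu, LTerm.value_mu]
    exact (hM.measure i).mono a ha _ _
      (inf_le_inf_right a (interp_imp_eq_top_iff.1 (hAB M hM))) inf_le_right

theorem iff_of_repl (hAB : Valid.{u, v, w} (.iff A B)) (h : Repl A B φ φ')
    (hφ : Formula.HereditarilyCoherent.{u, v, w} φ) : Valid.{u, v, w} (.iff φ φ') := fun _ hM =>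
  interp_iff_eq_top_iff.2 (interp_eq_of_repl hAB h hφ hM)

end Valid

theorem EventStr.isCoherent_of_valid
    (hle : ∀ k l, E.frame.prec k l → Valid.{u, v, w} (.imp (E.Φ k) (E.Φ l)))
    (hdisj : ∀ k l, k ≠ l → ¬ E.frame.prec k l → ¬ E.frame.prec l k →
      Valid.{u, v, w} (.neg (.and (E.Φ k) (E.Φ l)))) :
    EventStr.IsCoherent.{u, v, w} E := fun M hM =>
  { le := fun k l hkl => interp_imp_eq_top_iff.1 (hle k l hkl M hM)
    disjoint := fun k l hne hkl hlk =>
      disjoint_iff_inf_le.2 (interp_imp_eq_top_iff.1 (hdisj k l hne hkl hlk M hM)) }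

mutual

theorem WF.hereditarilyCoherent {φ : Formula Ag At} :
    WF φ → Formula.HereditarilyCoherent.{u, v, w} φ
  | .atom _ => trivial
  | .bot => trivial
  | .and h h' => ⟨h.hereditarilyCoherent, h'.hereditarilyCoherent⟩
  | .or h h' => ⟨h.hereditarilyCoherent, h'.hereditarilyCoherent⟩
  | .imp h h' => ⟨h.hereditarilyCoherent, h'.hereditarilyCoherent⟩
  | .dia h => h.hereditarilyCoherent
  | .box h => h.hereditarilyCoherent
  | .evDia hE h => ⟨hE.hereditarilyCoherent, h.hereditarilyCoherent⟩
  | .evBox hE h => ⟨hE.hereditarilyCoherent, h.hereditarilyCoherent⟩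
  | .prob h => fun k => (h k).hereditarilyCoherent

theorem WFEvent.hereditarilyCoherent {E : EventStr Ag At} :
    WFEvent E → EventStr.HereditarilyCoherent.{u, v, w} E
  | .mk _ hΦ hsub _ _ hle hdisj =>
    ⟨fun k => (hΦ k).hereditarilyCoherent, fun e p => (hsub e p).hereditarilyCoherent,
      isCoherent_of_valid (fun k l hkl => (hle k l hkl).valid)
        fun k l hne hkl hlk => (hdisj k l hne hkl hlk).valid⟩

theorem Provable.valid {φ : Formula Ag At} : Provable φ → Valid.{u, v, w} φ
  | .ax h hφ => h.valid hφ.hereditarilyCoherent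
  | .mp hAB hA => hAB.valid.mp hA.valid
  | .nec i hA => hA.valid.box i
  | .necE _ e hE hA => hA.valid.dBox hE.hereditarilyCoherent.2.2 e
  | .subMu i hAB => hAB.valid.geT_mu i
  | .subEq hAB hφ _ h => hAB.valid.iff_of_repl h hφ.hereditarilyCoherent

end

end Soundness

end IPDEL

theorem mainTheorem2 {Ag : Type u} {At : Type v} (φ : IPDEL.Formula Ag At)
    (hφ : IPDEL.Provable φ) (M : IPDEL.Model.{u, v, w} Ag At) (hM : M.IsAPE) :
    IPDEL.Model.interp φ M = ⊤ :=
  hφ.valid M hM
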